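/- Let $A$ and $B$ be associative unital rings (for instance algebras over a commutative ring $k$, with $k$ acting centrally on all bimodules). For a right $A$-module $M$ write $M^*=\mathrm{Hom}_A(M_A,A_A)$, and for a left $B$-module $N$ write ${}^*N=\mathrm{Hom}_B({}_BN,{}_BB)$. If $M$ is a $(B,A)$-bimodule, then $M^*$ and ${}^*M$ are $(A,B)$-bimodules via $(afb)(m)=a\,f(bm)$ and $(agb)(m)=g(ma)\,b$, respectively. A $B$-coring is a $(B,B)$-bimodule $\mathfrak D$ with bimodule maps $\Delta_{\mathfrak D}:\mathfrak D\to\mathfrak D\otimes_B\mathfrak D$, $d\mapsto\sum d_{(1)}\otimes_B d_{(2)}$, and $\varepsilon_{\mathfrak D}:\mathfrak D\to B$ that are coassociative and counital. It is called * *coseparable* if $\Delta_{\mathfrak D}$ is a split monomorphism of $\mathfrak D$-bicomodules; * *cosplit* if $\varepsilon_{\mathfrak D}$ is a split epimorphism of $(B,B)$-bimodules; * *Frobenius* if the forgetful functor from right $\mathfrak D$-comodules to right $B$-modules is a Frobenius functor, i.e. has a right adjoint that is also a left adjoint of it. A $(B,A)$-bimodule $M$ is called * *separable* if the evaluation map $M\otimes_A{}^*M\to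 B$, $m\otimes_A g\mapsto g(m)$, is a split epimorphism of $(B,B)$-bimodules; * *Frobenius* if ${}_BM$ and $M_A$ are finitely generated projective and $M^*\simeq{}^*M$ as $(A,B)$-bimodules. Let $\mathfrak D$ be a $B$-coring and let $\Sigma$ be a $(B,A)$-bimodule such that $\Sigma_A$ is finitely generated and projective, with finite dual basis $\{e_i,e_i^*\}$. Let $\Sigma[\mathfrak D]=\Sigma^*\otimes_B\mathfrak D\otimes_B\Sigma$ be the $A$-coring with $$\Delta(s^*\otimes_B d\otimes_B s)=\sum_i s^*\otimes_B d_{(1)}\otimes_B e_i\otimes_A e_i^*\otimes_B d_{(2)}\otimes_B s,\qquad \varepsilon(s^*\otimes_B d\otimes_B s)=s^*(\varepsilon_{\mathfrak D}(d)s);$$ this does not depend on the choice of the dual basis. Then: 1. If ${}_B\Sigma_A$ is a separable bimodule and $\mathfrak D$ is a coseparable $B$-coring, then $\Sigma[\mathfrak D]$ is a coseparable $A$-coring. 2. If ${}_A\Sigma^*_B$ is a separable bimodule and $\mathfrak D$ is a cosplit $B$-coring, then $\Sigma[\mathfrak D]$ is a cosplit $A$-coring. Conversely, if $\Sigma[\mathfrak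 D]$ is a cosplit $A$-coring, then ${}_A\Sigma^*_B$ is a separable bimodule. 3. If ${}_B\Sigma_A$ is a Frobenius bimodule and $\mathfrak D$ is a Frobenius $B$-coring, then $\Sigma[\mathfrak D]$ is a Frobenius $A$-coring. -/

import Mathlib

/-!
Corings over noncommutative rings. A left `R`-module is `Module R M`, a right `R`-module is
`Module Rᵐᵒᵖ M` (so `m r` is `MulOpposite.op r • m`), and an `(R, S)`-bimodule carries
`Module R M`, `Module Sᵐᵒᵖ M` and `SMulCommClass R Sᵐᵒᵖ M`.
-/

open MulOpposite

universe u

/-! ### The tensor product over a noncommutative ring -/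

/-- The additive relations `m a ⊗ n = m ⊗ a n` that are imposed on `M ⊗[ℤ] N`. -/
def NTensor.relations (A : Type*) (M : Type*) (N : Type*) [Ring A] [AddCommGroup M]
    [AddCommGroup N] [Module Aᵐᵒᵖ M] [Module A N] : Submodule ℤ (TensorProduct ℤ M N) :=
  Submodule.span ℤ
    {t | ∃ (m : M) (a : A) (n : N),
      t = TensorProduct.tmul ℤ (op a • m) n - TensorProduct.tmul ℤ m (a • n)}

/-- The tensor product `M ⊗_A N` of a right `A`-module `M` and a left `A`-module `N` over a ring
`A`, not necessarily commutative: the quotient of `M ⊗[ℤ] N` by `m a ⊗ n = m ⊗ a n`. -/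
def NTensor (A : Type*) (M : Type*) (N : Type*) [Ring A] [AddCommGroup M]
    [AddCommGroup N] [Module Aᵐᵒᵖ M] [Module A N] : Type _ :=
  TensorProduct ℤ M N ⧸ NTensor.relations A M N

namespace NTensor

section Basic

variable {A : Type*} {M : Type*} {N : Type*} {P : Type*} [Ring A] [AddCommGroup M]
  [AddCommGroup N] [AddCommGroup P] [Module Aᵐᵒᵖ M] [Module A N]

instance : AddCommGroup (NTensor A M N) :=
  inferInstanceAs (AddCommGroup (TensorProduct ℤ M N ⧸ NTensor.relations A M N))

variable (A) in
/-- The class `m ⊗_A n`. -/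
def tmul (m : M) (n : N) : NTensor A M N :=
  Submodule.Quotient.mk (TensorProduct.tmul ℤ m n)

theorem add_tmul (m m' : M) (n : N) : tmul A (m + m') n = tmul A m n + tmul A m' n := by
  unfold tmul
  rw [TensorProduct.add_tmul]
  rfl

theorem tmul_add (m : M) (n n' : N) : tmul A m (n + n') = tmul A m n + tmul A m n' := by
  unfold tmul
  rw [TensorProduct.tmul_add]
  rfl

theorem smul_tmul (a : A) (m : M) (n : N) : tmul A (op a • m) n = tmul A m (a • n) :=
  (Submodule.Quotient.eq _).2 (Submodule.subset_span ⟨m, a, n, rfl⟩)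

theorem zero_tmul (n : N) : tmul A (0 : M) n = 0 := by
  have h := add_tmul (A := A) (0 : M) 0 n
  rw [add_zero] at h
  exact left_eq_add.mp h

theorem tmul_zero (m : M) : tmul A m (0 : N) = 0 := by
  have h := tmul_add (A := A) m (0 : N) 0
  rw [add_zero] at h
  exact left_eq_add.mp h

theorem sum_tmul {ι : Type*} (s : Finset ι) (f : ι → M) (n : N) :
    tmul A (∑ i ∈ s, f i) n = ∑ i ∈ s, tmul A (f i) n :=
  map_sum (AddMonoidHom.mk' (fun m : M => tmul A m n) (fun x y => add_tmul x y n)) f s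

theorem tmul_sum {ι : Type*} (s : Finset ι) (m : M) (f : ι → N) :
    tmul A m (∑ i ∈ s, f i) = ∑ i ∈ s, tmul A m (f i) :=
  map_sum (AddMonoidHom.mk' (fun n : N => tmul A m n) (fun x y => tmul_add m x y)) f s

@[elab_as_elim]
theorem induction {p : NTensor A M N → Prop} (t : NTensor A M N) (zero : p 0)
    (tmul : ∀ m n, p (tmul A m n)) (add : ∀ x y, p x → p y → p (x + y)) : p t := by
  obtain ⟨x, rfl⟩ := Submodule.Quotient.mk_surjective _ t
  induction x using TensorProduct.induction_on with
  | zero => exact zero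
  | tmul m n => exact tmul m n
  | add x y hx hy => exact add _ _ hx hy

/-- The universal property: a biadditive `A`-balanced map factors through `M ⊗_A N`. -/
def lift (f : M → N → P) (hl : ∀ m m' n, f (m + m') n = f m n + f m' n)
    (hr : ∀ m n n', f m (n + n') = f m n + f m n')
    (hb : ∀ (a : A) m n, f (op a • m) n = f m (a • n)) : NTensor A M N →+ P :=
  ((NTensor.relations A M N).liftQ
    (TensorProduct.liftAddHom
      (AddMonoidHom.mk' (fun m => AddMonoidHom.mk' (f m) (hr m))
        (fun m m' => AddMonoidHom.ext (hl m m')))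
      (fun z m n => by
        simp only [map_zsmul, AddMonoidHom.smul_apply])).toIntLinearMap
    (by
      refine Submodule.span_le.2 ?_
      rintro t ⟨m, a, n, rfl⟩
      simp only [SetLike.mem_coe, LinearMap.mem_ker, map_sub, AddMonoidHom.coe_toIntLinearMap,
        TensorProduct.liftAddHom_tmul, AddMonoidHom.mk'_apply, hb, sub_self])).toAddMonoidHom

theorem lift_tmul (f : M → N → P) (hl : ∀ m m' n, f (m + m') n = f m n + f m' n)
    (hr : ∀ m n n', f m (n + n') = f m n + f m n')
    (hb : ∀ (a : A) m n, f (op a • m) n = f m (a • n)) (m : M) (n : N) :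
    lift f hl hr hb (tmul A m n) = f m n := by
  rfl

theorem hom_ext {f g : NTensor A M N →+ P} (h : ∀ m n, f (tmul A m n) = g (tmul A m n)) :
    f = g := by
  ext t
  induction t using NTensor.induction with
  | zero => rw [map_zero, map_zero]
  | tmul m n => exact h m n
  | add x y hx hy => rw [map_add, map_add, hx, hy]

end Basic

/-! #### Bimodule structures on tensor products -/

section Left

variable {R : Type*} {A : Type*} {M : Type*} {N : Type*} [Ring R] [Ring A] [AddCommGroup M]
  [AddCommGroup N] [Module R M] [Module Aᵐᵒᵖ M] [SMulCommClass R Aᵐᵒᵖ M] [Module A N]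

/-- `r (m ⊗ n) = r m ⊗ n`. -/
def leftAct (r : R) : NTensor A M N →+ NTensor A M N :=
  lift (fun m n => tmul A (r • m) n) (fun m m' n => by rw [smul_add, add_tmul])
    (fun m n n' => tmul_add _ _ _) (fun a m n => by rw [smul_comm, smul_tmul])

instance : Module R (NTensor A M N) where
  smul r t := leftAct r t
  one_smul t := DFunLike.congr_fun (f := leftAct (A := A) (M := M) (N := N) (1 : R))
    (g := AddMonoidHom.id _)
    (hom_ext fun m n => congrArg (fun x => tmul A x n) (one_smul R m)) t
  mul_smul r s t := DFunLike.congr_fun (f := leftAct (A := A) (M := M) (N := N) (r * s))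
    (g := (leftAct r).comp (leftAct s))
    (hom_ext fun m n => congrArg (fun x => tmul A x n) (mul_smul r s m)) t
  smul_zero r := map_zero (leftAct r)
  smul_add r := map_add (leftAct r)
  add_smul r s t := DFunLike.congr_fun (f := leftAct (A := A) (M := M) (N := N) (r + s))
    (g := leftAct r + leftAct s)
    (hom_ext fun m n => (congrArg (fun x => tmul A x n) (add_smul r s m)).trans
      (add_tmul _ _ _)) t
  zero_smul t := DFunLike.congr_fun (f := leftAct (A := A) (M := M) (N := N) (0 : R))
    (g := 0)
    (hom_ext fun m n => (congrArg (fun x => tmul A x n) (zero_smul R m)).trans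
      (zero_tmul _)) t

theorem left_smul_tmul (r : R) (m : M) (n : N) : r • tmul A m n = tmul A (r • m) n := rfl

end Left

section Right

variable {S : Type*} {A : Type*} {M : Type*} {N : Type*} [Ring S] [Ring A] [AddCommGroup M]
  [AddCommGroup N] [Module Aᵐᵒᵖ M] [Module A N] [Module Sᵐᵒᵖ N] [SMulCommClass A Sᵐᵒᵖ N]

/-- `(m ⊗ n) s = m ⊗ n s`. -/
def rightAct (s : Sᵐᵒᵖ) : NTensor A M N →+ NTensor A M N :=
  lift (fun m n => tmul A m (s • n)) (fun m m' n => add_tmul _ _ _)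
    (fun m n n' => by rw [smul_add, tmul_add]) (fun a m n => by rw [smul_tmul, smul_comm])

instance : Module Sᵐᵒᵖ (NTensor A M N) where
  smul r t := rightAct r t
  one_smul t := DFunLike.congr_fun (f := rightAct (A := A) (M := M) (N := N) (1 : Sᵐᵒᵖ))
    (g := AddMonoidHom.id _)
    (hom_ext fun m n => congrArg (fun x => tmul A m x) (one_smul Sᵐᵒᵖ n)) t
  mul_smul r s t := DFunLike.congr_fun (f := rightAct (A := A) (M := M) (N := N) (r * s))
    (g := (rightAct r).comp (rightAct s))
    (hom_ext fun m n => congrArg (fun x => tmul A m x) (mul_smul r s n)) t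
  smul_zero r := map_zero (rightAct r)
  smul_add r := map_add (rightAct r)
  add_smul r s t := DFunLike.congr_fun (f := rightAct (A := A) (M := M) (N := N) (r + s))
    (g := rightAct r + rightAct s)
    (hom_ext fun m n => (congrArg (fun x => tmul A m x) (add_smul r s n)).trans
      (tmul_add _ _ _)) t
  zero_smul t := DFunLike.congr_fun (f := rightAct (A := A) (M := M) (N := N) (0 : Sᵐᵒᵖ))
    (g := 0)
    (hom_ext fun m n => (congrArg (fun x => tmul A m x) (zero_smul Sᵐᵒᵖ n)).trans
      (tmul_zero _)) t

theorem right_smul_tmul (s : Sᵐᵒᵖ) (m : M) (n : N) : s • tmul A m n = tmul A m (s • n) := rfl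

instance {R : Type*} [Ring R] [Module R M] [SMulCommClass R Aᵐᵒᵖ M] :
    SMulCommClass R Sᵐᵒᵖ (NTensor A M N) where
  smul_comm r s t := by
    induction t using NTensor.induction with
    | zero => simp only [smul_zero]
    | tmul m n => rw [right_smul_tmul, left_smul_tmul, left_smul_tmul, right_smul_tmul]
    | add x y hx hy => rw [smul_add, smul_add, smul_add, smul_add, hx, hy]

end Right

/-! #### Functoriality, associativity and unit maps -/

section Map

variable {A : Type*} {M : Type*} {N : Type*} {M' : Type*} {N' : Type*} [Ring A]
  [AddCommGroup M] [AddCommGroup N] [AddCommGroup M'] [AddCommGroup N']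
  [Module Aᵐᵒᵖ M] [Module A N] [Module Aᵐᵒᵖ M'] [Module A N']

/-- `f ⊗_A g` for a right `A`-linear `f` and a left `A`-linear `g`. -/
def map (f : M →ₗ[Aᵐᵒᵖ] M') (g : N →ₗ[A] N') : NTensor A M N →+ NTensor A M' N' :=
  lift (fun m n => tmul A (f m) (g n)) (fun m m' n => by rw [map_add, add_tmul])
    (fun m n n' => by rw [map_add, tmul_add])
    (fun a m n => by rw [map_smul, map_smul, smul_tmul])

theorem map_tmul (f : M →ₗ[Aᵐᵒᵖ] M') (g : N →ₗ[A] N') (m : M) (n : N) :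
    map f g (tmul A m n) = tmul A (f m) (g n) := rfl

end Map

section Assoc

variable (A : Type*) (B : Type*) (M : Type*) (N : Type*) (P : Type*) [Ring A] [Ring B]
  [AddCommGroup M] [AddCommGroup N] [AddCommGroup P]
  [Module Aᵐᵒᵖ M] [Module A N] [Module Bᵐᵒᵖ N] [SMulCommClass A Bᵐᵒᵖ N] [Module B P]

/-- `(m ⊗ n) ⊗ p ↦ m ⊗ (n ⊗ p)`. -/
def assocHom : NTensor B (NTensor A M N) P →+ NTensor A M (NTensor B N P) :=
  lift
    (fun t p => lift (fun m n => tmul A m (tmul B n p)) (fun _ _ _ => add_tmul _ _ _)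
      (fun m n n' => by rw [add_tmul, tmul_add])
      (fun a m n => by rw [smul_tmul, left_smul_tmul]) t)
    (fun t t' p => map_add _ _ _)
    (fun t p p' => by
      induction t using NTensor.induction with
      | zero => simp only [map_zero, add_zero]
      | tmul m n => simp only [lift_tmul, tmul_add]
      | add x y hx hy => rw [map_add, map_add, map_add, hx, hy]; abel)
    (fun b t p => by
      induction t using NTensor.induction with
      | zero => simp only [map_zero, smul_zero]
      | tmul m n => rw [right_smul_tmul, lift_tmul, lift_tmul, smul_tmul]
      | add x y hx hy => rw [smul_add, map_add, map_add, hx, hy])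

/-- `m ⊗ (n ⊗ p) ↦ (m ⊗ n) ⊗ p`. -/
def assocInv : NTensor A M (NTensor B N P) →+ NTensor B (NTensor A M N) P :=
  lift
    (fun m t => lift (fun n p => tmul B (tmul A m n) p)
      (fun n n' p => by rw [tmul_add, add_tmul])
      (fun _ _ _ => tmul_add _ _ _)
      (fun b n p => by rw [← right_smul_tmul, smul_tmul]) t)
    (fun m m' t => by
      induction t using NTensor.induction with
      | zero => simp only [map_zero, add_zero]
      | tmul n p => simp only [lift_tmul, add_tmul]
      | add x y hx hy => rw [map_add, map_add, map_add, hx, hy]; abel)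
    (fun m t t' => map_add _ _ _)
    (fun a m t => by
      induction t using NTensor.induction with
      | zero => simp only [map_zero, smul_zero]
      | tmul n p => rw [left_smul_tmul, lift_tmul, lift_tmul, smul_tmul]
      | add x y hx hy => rw [smul_add, map_add, map_add, hx, hy])

/-- The associativity isomorphism `(M ⊗_A N) ⊗_B P ≃ M ⊗_A (N ⊗_B P)`. -/
def assoc : NTensor B (NTensor A M N) P ≃+ NTensor A M (NTensor B N P) :=
  AddMonoidHom.toAddEquiv (assocHom A B M N P) (assocInv A B M N P)
    (hom_ext fun t p => by
      induction t using NTensor.induction with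
      | zero => rw [zero_tmul, map_zero, map_zero]
      | tmul m n => rfl
      | add x y hx hy => rw [add_tmul, map_add, map_add, hx, hy])
    (hom_ext fun m t => by
      induction t using NTensor.induction with
      | zero => rw [tmul_zero, map_zero, map_zero]
      | tmul n p => rfl
      | add x y hx hy => rw [tmul_add, map_add, map_add, hx, hy])

variable {A B M N P} in
theorem assoc_tmul (m : M) (n : N) (p : P) :
    assoc A B M N P (tmul B (tmul A m n) p) = tmul A m (tmul B n p) := rfl

/-- The canonical map `A ⊗_A N → N`, `a ⊗ n ↦ a n`. -/
def lid : NTensor A A N →+ N :=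
  lift (fun a n => a • n) (fun _ _ _ => add_smul _ _ _) (fun _ _ _ => smul_add _ _ _)
    (fun a x n => by rw [op_smul_eq_mul, mul_smul])

/-- The canonical map `M ⊗_A A → M`, `m ⊗ a ↦ m a`. -/
def rid : NTensor A M A →+ M :=
  lift (fun m a => op a • m) (fun _ _ _ => smul_add _ _ _)
    (fun _ _ _ => by rw [op_add, add_smul])
    (fun a m x => by rw [smul_eq_mul, op_mul, mul_smul])

variable {A N} in
theorem lid_tmul (a : A) (n : N) : lid A N (tmul A a n) = a • n := rfl

variable {A M} in
theorem rid_tmul (m : M) (a : A) : rid A M (tmul A m a) = op a • m := rfl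

end Assoc

end NTensor

/-! ### Bimodule maps and duals -/

/-- Homomorphisms of `(R, S)`-bimodules. -/
structure BimodHom (R : Type*) (S : Type*) (M : Type*) (N : Type*) [Ring R] [Ring S]
    [AddCommGroup M] [AddCommGroup N] [Module R M] [Module Sᵐᵒᵖ M] [Module R N] [Module Sᵐᵒᵖ N]
    where
  /-- the underlying additive map -/
  toAddHom : M →+ N
  map_left : ∀ (r : R) (m : M), toAddHom (r • m) = r • toAddHom m
  map_right : ∀ (s : S) (m : M), toAddHom (op s • m) = op s • toAddHom m

namespace BimodHom

variable {R : Type*} {S : Type*} {M : Type*} {N : Type*} [Ring R] [Ring S]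
    [AddCommGroup M] [AddCommGroup N] [Module R M] [Module Sᵐᵒᵖ M] [Module R N] [Module Sᵐᵒᵖ N]

instance : CoeFun (BimodHom R S M N) (fun _ => M → N) := ⟨fun f => f.toAddHom⟩

/-- The underlying left linear map. -/
def left (f : BimodHom R S M N) : M →ₗ[R] N where
  toFun := f
  map_add' := map_add f.toAddHom
  map_smul' := f.map_left

/-- The underlying right linear map. -/
def right (f : BimodHom R S M N) : M →ₗ[Sᵐᵒᵖ] N where
  toFun := f
  map_add' := map_add f.toAddHom
  map_smul' s m := f.map_right s.unop m

end BimodHom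

/-- The right dual `M^* = Hom_A(M_A, A_A)` of a right `A`-module `M`. -/
def RDual (A : Type*) (M : Type*) [Ring A] [AddCommGroup M] [Module Aᵐᵒᵖ M] : Type _ :=
  M →ₗ[Aᵐᵒᵖ] A

namespace RDual

variable {A : Type*} {M : Type*} [Ring A] [AddCommGroup M] [Module Aᵐᵒᵖ M]

instance : AddCommGroup (RDual A M) := inferInstanceAs (AddCommGroup (M →ₗ[Aᵐᵒᵖ] A))

instance : FunLike (RDual A M) M A := inferInstanceAs (FunLike (M →ₗ[Aᵐᵒᵖ] A) M A)

instance : LinearMapClass (RDual A M) Aᵐᵒᵖ M A :=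
  inferInstanceAs (LinearMapClass (M →ₗ[Aᵐᵒᵖ] A) Aᵐᵒᵖ M A)

@[ext] theorem ext {f g : RDual A M} (h : ∀ m, f m = g m) : f = g := LinearMap.ext h

theorem add_apply (f g : RDual A M) (m : M) : (f + g) m = f m + g m := rfl

theorem map_op_smul (f : RDual A M) (a : A) (m : M) : f (op a • m) = f m * a :=
  LinearMap.map_smul (f : M →ₗ[Aᵐᵒᵖ] A) (op a) m

/-- `(a f)(m) = a f(m)`. -/
instance : Module A (RDual A M) := inferInstanceAs (Module A (M →ₗ[Aᵐᵒᵖ] A))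

theorem smul_apply (a : A) (f : RDual A M) (m : M) : (a • f) m = a * f m := rfl

variable {B : Type*} [Ring B] [Module B M] [SMulCommClass B Aᵐᵒᵖ M]

/-- `(f b)(m) = f(b m)`. -/
instance : Module Bᵐᵒᵖ (RDual A M) where
  smul b f :=
    ({ toFun := fun m => f (b.unop • m)
       map_add' := fun x y => by rw [smul_add, map_add]
       map_smul' := fun a x => by
        rw [smul_comm, map_smul, RingHom.id_apply] } : M →ₗ[Aᵐᵒᵖ] A)
  one_smul f := RDual.ext fun m => congrArg f (one_smul B m)
  mul_smul b c f := RDual.ext fun m => congrArg f (mul_smul c.unop b.unop m)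
  smul_zero b := rfl
  smul_add b f g := rfl
  add_smul b c f := RDual.ext fun m =>
    (congrArg f (add_smul b.unop c.unop m)).trans (map_add f _ _)
  zero_smul f := RDual.ext fun m => (congrArg f (zero_smul B m)).trans (map_zero f)

theorem op_smul_apply (b : B) (f : RDual A M) (m : M) : (op b • f) m = f (b • m) := rfl

instance : SMulCommClass A Bᵐᵒᵖ (RDual A M) where
  smul_comm _ _ _ := rfl

end RDual

/-- The left dual `^*M = Hom_B(_B M, _B B)` of a left `B`-module `M`. -/
def LDual (B : Type*) (M : Type*) [Ring B] [AddCommGroup M] [Module B M] : Type _ :=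
  M →ₗ[B] B

namespace LDual

variable {B : Type*} {M : Type*} [Ring B] [AddCommGroup M] [Module B M]

instance : AddCommGroup (LDual B M) := inferInstanceAs (AddCommGroup (M →ₗ[B] B))

instance : FunLike (LDual B M) M B := inferInstanceAs (FunLike (M →ₗ[B] B) M B)

instance : LinearMapClass (LDual B M) B M B :=
  inferInstanceAs (LinearMapClass (M →ₗ[B] B) B M B)

@[ext] theorem ext {f g : LDual B M} (h : ∀ m, f m = g m) : f = g := LinearMap.ext h

theorem add_apply (f g : LDual B M) (m : M) : (f + g) m = f m + g m := rfl

/-- `(f b)(m) = f(m) b`. -/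
instance : Module Bᵐᵒᵖ (LDual B M) := inferInstanceAs (Module Bᵐᵒᵖ (M →ₗ[B] B))

theorem op_smul_apply (b : B) (f : LDual B M) (m : M) : (op b • f) m = f m * b := rfl

variable {A : Type*} [Ring A] [Module Aᵐᵒᵖ M] [SMulCommClass B Aᵐᵒᵖ M]

/-- `(a f)(m) = f(m a)`. -/
instance : Module A (LDual B M) where
  smul a f :=
    ({ toFun := fun m => f (op a • m)
       map_add' := fun x y => by rw [smul_add, map_add]
       map_smul' := fun b x => by
        rw [← smul_comm, map_smul, RingHom.id_apply] } : M →ₗ[B] B)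
  one_smul f := LDual.ext fun m => congrArg f (one_smul Aᵐᵒᵖ m)
  mul_smul b c f := LDual.ext fun m => congrArg f (mul_smul (op c) (op b) m)
  smul_zero b := rfl
  smul_add b f g := rfl
  add_smul b c f := LDual.ext fun m =>
    (congrArg f (add_smul (op b) (op c) m)).trans (map_add f _ _)
  zero_smul f := LDual.ext fun m => (congrArg f (zero_smul Aᵐᵒᵖ m)).trans (map_zero f)

theorem smul_apply (a : A) (f : LDual B M) (m : M) : (a • f) m = f (op a • m) := rfl

instance : SMulCommClass A Bᵐᵒᵖ (LDual B M) where
  smul_comm _ _ _ := rfl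

end LDual

/-! ### Separable and Frobenius bimodules -/

section Bimodules

variable (B : Type*) (A : Type*) (M : Type*) [Ring B] [Ring A] [AddCommGroup M]
  [Module B M] [Module Aᵐᵒᵖ M] [SMulCommClass B Aᵐᵒᵖ M]

/-- The evaluation map `M ⊗_A ^*M → B`, `m ⊗ f ↦ f m`, of `(B, B)`-bimodules. -/
def evalBimod : BimodHom B B (NTensor A M (LDual B M)) B where
  toAddHom := NTensor.lift (fun m f => f m) (fun m m' f => map_add f m m')
    (fun m f f' => LDual.add_apply f f' m) (fun a m f => (LDual.smul_apply a f m).symm)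
  map_left b t := by
    induction t using NTensor.induction with
    | zero => simp only [smul_zero, map_zero]
    | tmul m f => rw [NTensor.left_smul_tmul, NTensor.lift_tmul, NTensor.lift_tmul, map_smul]
    | add x y hx hy => rw [smul_add, map_add, map_add, hx, hy, smul_add]
  map_right b t := by
    induction t using NTensor.induction with
    | zero => simp only [smul_zero, map_zero]
    | tmul m f =>
      rw [NTensor.right_smul_tmul, NTensor.lift_tmul, NTensor.lift_tmul, LDual.op_smul_apply,
        op_smul_eq_mul]
    | add x y hx hy => rw [smul_add, map_add, map_add, hx, hy, smul_add]

/-- A `(B, A)`-bimodule `M` is separable if `M ⊗_A ^*M → B` is a split epimorphism of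
`(B, B)`-bimodules. -/
def IsSeparableBimodule : Prop :=
  ∃ σ : BimodHom B B B (NTensor A M (LDual B M)), ∀ b : B, evalBimod B A M (σ b) = b

/-- A `(B, A)`-bimodule `M` is Frobenius if it is finitely generated projective on both sides and
`M^* ≃ ^*M` as `(A, B)`-bimodules. -/
structure IsFrobeniusBimodule : Prop where
  finite_left : Module.Finite B M
  projective_left : Module.Projective B M
  finite_right : Module.Finite Aᵐᵒᵖ M
  projective_right : Module.Projective Aᵐᵒᵖ M
  exists_iso : ∃ γ : BimodHom A B (RDual A M) (LDual B M), Function.Bijective γ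

end Bimodules

/-! ### Corings -/

/-- An `A`-coring structure on an `(A, A)`-bimodule `C`. -/
structure Coring (A : Type*) (C : Type*) [Ring A] [AddCommGroup C] [Module A C] [Module Aᵐᵒᵖ C]
    [SMulCommClass A Aᵐᵒᵖ C] where
  /-- comultiplication -/
  comul : BimodHom A A C (NTensor A C C)
  /-- counit -/
  counit : BimodHom A A C A
  coassoc : ∀ c, NTensor.assoc A A C C C (NTensor.map comul.right LinearMap.id (comul c)) =
    NTensor.map LinearMap.id comul.left (comul c)
  counit_left : ∀ c, NTensor.lid A C (NTensor.map counit.right LinearMap.id (comul c)) = c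
  counit_right : ∀ c, NTensor.rid A C (NTensor.map LinearMap.id counit.left (comul c)) = c

namespace Coring

section Properties

variable {A : Type*} {C : Type*} [Ring A] [AddCommGroup C] [Module A C] [Module Aᵐᵒᵖ C]
    [SMulCommClass A Aᵐᵒᵖ C]

/-- `C` is cosplit if its counit is a split epimorphism of `(A, A)`-bimodules. -/
def IsCosplit (𝔠 : Coring A C) : Prop :=
  ∃ σ : BimodHom A A A C, ∀ a : A, 𝔠.counit (σ a) = a

/-- `C` is coseparable if its comultiplication is a split monomorphism of `C`-bicomodules. Here
`C ⊗_A C` has the left coaction `Δ ⊗ C` and the right coaction `C ⊗ Δ`, so that the two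
colinearity conditions for `ν` read `Δ ∘ ν = (C ⊗ ν) ∘ (Δ ⊗ C)` and
`Δ ∘ ν = (ν ⊗ C) ∘ (C ⊗ Δ)`. -/
def IsCoseparable (𝔠 : Coring A C) : Prop :=
  ∃ ν : BimodHom A A (NTensor A C C) C,
    (∀ c, ν (𝔠.comul c) = c) ∧
    (∀ t, 𝔠.comul (ν t) = NTensor.map LinearMap.id ν.left
      (NTensor.assoc A A C C C (NTensor.map 𝔠.comul.right LinearMap.id t))) ∧
    (∀ t, 𝔠.comul (ν t) = NTensor.map ν.right LinearMap.id
      ((NTensor.assoc A A C C C).symm (NTensor.map LinearMap.id 𝔠.comul.left t)))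

end Properties

/-! #### Right comodules, the forgetful functor and Frobenius corings -/

section Comodules

variable {A : Type u} {C : Type u} [Ring A] [AddCommGroup C] [Module A C] [Module Aᵐᵒᵖ C]
    [SMulCommClass A Aᵐᵒᵖ C]

/-- Right comodules over an `A`-coring. -/
structure RComod (𝔠 : Coring A C) : Type (u + 1) where
  /-- the underlying right `A`-module -/
  X : ModuleCat.{u} Aᵐᵒᵖ
  /-- the coaction -/
  coact : X →ₗ[Aᵐᵒᵖ] NTensor A X C
  coassoc : ∀ x, NTensor.assoc A A X C C (NTensor.map coact LinearMap.id (coact x)) =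
    NTensor.map LinearMap.id 𝔠.comul.left (coact x)
  counit : ∀ x, NTensor.rid A X (NTensor.map LinearMap.id 𝔠.counit.left (coact x)) = x

/-- Morphisms of right comodules: right `A`-linear colinear maps. -/
@[ext]
structure RComod.Hom {𝔠 : Coring A C} (X Y : RComod 𝔠) where
  /-- the underlying map of right `A`-modules -/
  hom : X.X ⟶ Y.X
  colinear : ∀ x, Y.coact (hom.hom x) = NTensor.map hom.hom LinearMap.id (X.coact x)

instance (𝔠 : Coring A C) : CategoryTheory.Category (RComod 𝔠) where
  Hom := RComod.Hom
  id X := ⟨CategoryTheory.CategoryStruct.id X.X, fun x => by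
    have h : NTensor.map (LinearMap.id : X.X →ₗ[Aᵐᵒᵖ] X.X) (LinearMap.id : C →ₗ[A] C) =
      AddMonoidHom.id _ := NTensor.hom_ext fun _ _ => rfl
    exact (DFunLike.congr_fun h (X.coact x)).symm⟩
  comp {X Y Z} f g := ⟨CategoryTheory.CategoryStruct.comp f.hom g.hom, fun x => by
    have h : (NTensor.map g.hom.hom (LinearMap.id : C →ₗ[A] C)).comp
        (NTensor.map f.hom.hom (LinearMap.id : C →ₗ[A] C)) =
      NTensor.map (CategoryTheory.CategoryStruct.comp f.hom g.hom).hom LinearMap.id :=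
      NTensor.hom_ext fun _ _ => rfl
    rw [← h, AddMonoidHom.comp_apply, ← f.colinear, ← g.colinear]
    rfl⟩
  id_comp f := RComod.Hom.ext (CategoryTheory.Category.id_comp f.hom)
  comp_id f := RComod.Hom.ext (CategoryTheory.Category.comp_id f.hom)
  assoc f g h := RComod.Hom.ext (CategoryTheory.Category.assoc f.hom g.hom h.hom)

/-- The forgetful functor from right `C`-comodules to right `A`-modules. -/
def forgetComod (𝔠 : Coring A C) : CategoryTheory.Functor (RComod 𝔠) (ModuleCat.{u} Aᵐᵒᵖ) where
  obj X := X.X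
  map f := f.hom
  map_id _ := rfl
  map_comp _ _ := rfl

end Comodules

end Coring

open CategoryTheory in
/-- A functor is Frobenius if some functor is both a right and a left adjoint of it. -/
def IsFrobeniusFunctor {𝒞 : Type*} {𝒟 : Type*} [Category 𝒞] [Category 𝒟] (F : 𝒞 ⥤ 𝒟) : Prop :=
  ∃ G : 𝒟 ⥤ 𝒞, Nonempty (F ⊣ G) ∧ Nonempty (G ⊣ F)

/-- A coring is Frobenius if the forgetful functor from its right comodules to right `A`-modules
is a Frobenius functor. -/
def Coring.IsFrobenius {A : Type u} {C : Type u} [Ring A] [AddCommGroup C] [Module A C]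
    [Module Aᵐᵒᵖ C] [SMulCommClass A Aᵐᵒᵖ C] (𝔠 : Coring A C) : Prop :=
  IsFrobeniusFunctor 𝔠.forgetComod

/-! ### Dual bases -/

/-- A finite dual basis of a right `A`-module: `m = ∑ e_i e_i^*(m)` for all `m`. -/
structure DualBasis (A : Type*) (M : Type*) [Ring A] [AddCommGroup M] [Module Aᵐᵒᵖ M] where
  /-- the number of elements -/
  n : ℕ
  /-- the elements -/
  e : Fin n → M
  /-- the functionals -/
  f : Fin n → RDual A M
  sum_eq : ∀ m, ∑ i, op (f i m) • e i = m

/-- A finitely generated projective right module has a finite dual basis. -/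
theorem DualBasis.nonempty (A : Type*) (M : Type*) [Ring A] [AddCommGroup M] [Module Aᵐᵒᵖ M]
    [Module.Finite Aᵐᵒᵖ M] [Module.Projective Aᵐᵒᵖ M] : Nonempty (DualBasis A M) := by
  obtain ⟨n, p, hp⟩ := Module.Finite.exists_fin' Aᵐᵒᵖ M
  obtain ⟨s, hs⟩ := Module.projective_lifting_property p LinearMap.id hp
  refine ⟨⟨n, fun i => p (Pi.single i 1), fun i =>
    ({ toFun := fun m => (s m i).unop
       map_add' := fun x y => by rw [map_add, Pi.add_apply, unop_add]
       map_smul' := fun a x => by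
        rw [map_smul, Pi.smul_apply, smul_eq_mul, unop_mul]; rfl } : M →ₗ[Aᵐᵒᵖ] A), ?_⟩⟩
  intro m
  have h1 : p (s m) = m := LinearMap.congr_fun hs m
  conv_rhs => rw [← h1, pi_eq_sum_univ' (s m)]
  rw [map_sum]
  refine Finset.sum_congr rfl fun i _ => ?_
  rw [map_smul]
  congr 2

/-- A chosen finite dual basis of a finitely generated projective right module. -/
noncomputable def dualBasis (A : Type*) (M : Type*) [Ring A] [AddCommGroup M] [Module Aᵐᵒᵖ M]
    [Module.Finite Aᵐᵒᵖ M] [Module.Projective Aᵐᵒᵖ M] : DualBasis A M :=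
  Classical.choice (DualBasis.nonempty A M)

/-- The dual basis commutes with the left action: `∑ b e_i ⊗ e_i^* = ∑ e_i ⊗ e_i^* b`, stated for
the values of any `A`-balanced biadditive map. -/
theorem DualBasis.sum_balanced {A : Type*} {B : Type*} {M : Type*} {P : Type*} [Ring A] [Ring B]
    [AddCommGroup M] [AddCommGroup P] [Module B M] [Module Aᵐᵒᵖ M] [SMulCommClass B Aᵐᵒᵖ M]
    (E : DualBasis A M) (F : NTensor A M (RDual A M) →+ P) (b : B) :
    ∑ i, F (NTensor.tmul A (b • E.e i) (E.f i)) =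
      ∑ i, F (NTensor.tmul A (E.e i) (op b • E.f i)) := by
  have h1 : ∀ i, b • E.e i = ∑ j, op (E.f j (b • E.e i)) • E.e j := fun i => (E.sum_eq _).symm
  have h2 : ∀ j, op b • E.f j = ∑ i, (E.f j (b • E.e i)) • E.f i := fun j => by
    refine RDual.ext fun m => ?_
    have hs : (∑ i, (E.f j (b • E.e i)) • E.f i) m = ∑ i, ((E.f j (b • E.e i)) • E.f i) m :=
      LinearMap.sum_apply _ _ _
    rw [hs, RDual.op_smul_apply]
    conv_lhs => rw [← E.sum_eq m, Finset.smul_sum, map_sum]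
    refine Finset.sum_congr rfl fun i _ => ?_
    rw [smul_comm, RDual.map_op_smul, RDual.smul_apply]
  calc ∑ i, F (NTensor.tmul A (b • E.e i) (E.f i))
      = ∑ i, ∑ j, F (NTensor.tmul A (E.e j) (E.f j (b • E.e i) • E.f i)) := by
        refine Finset.sum_congr rfl fun i _ => ?_
        conv_lhs => rw [h1 i, NTensor.sum_tmul, map_sum]
        refine Finset.sum_congr rfl fun j _ => ?_
        rw [NTensor.smul_tmul]
    _ = ∑ j, F (NTensor.tmul A (E.e j) (op b • E.f j)) := by
        rw [Finset.sum_comm]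
        refine Finset.sum_congr rfl fun j _ => ?_
        rw [h2 j, NTensor.tmul_sum, map_sum]

/-! ### Base ring extension of a coring by a bimodule -/

/-- The `(A, A)`-bimodule `M^* ⊗_B D ⊗_B M`. -/
abbrev BaseExt (B : Type*) (A : Type*) (D : Type*) (M : Type*) [Ring B] [Ring A]
    [AddCommGroup D] [Module B D] [Module Bᵐᵒᵖ D] [SMulCommClass B Bᵐᵒᵖ D]
    [AddCommGroup M] [Module B M] [Module Aᵐᵒᵖ M] [SMulCommClass B Aᵐᵒᵖ M] : Type _ :=
  NTensor B (RDual A M) (NTensor B D M)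

namespace BaseExt

variable {B : Type*} {A : Type*} {D : Type*} {M : Type*} [Ring B] [Ring A]
    [AddCommGroup D] [Module B D] [Module Bᵐᵒᵖ D] [SMulCommClass B Bᵐᵒᵖ D]
    [AddCommGroup M] [Module B M] [Module Aᵐᵒᵖ M] [SMulCommClass B Aᵐᵒᵖ M]

/-- The element `f ⊗ d ⊗ m`. -/
def tri (f : RDual A M) (d : D) (m : M) : BaseExt B A D M :=
  NTensor.tmul B f (NTensor.tmul B d m)

theorem tri_add_left (f f' : RDual A M) (d : D) (m : M) :
    tri (B := B) (f + f') d m = tri f d m + tri f' d m := NTensor.add_tmul _ _ _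

theorem tri_add_mid (f : RDual A M) (d d' : D) (m : M) :
    tri (B := B) f (d + d') m = tri f d m + tri f d' m := by
  unfold tri; rw [NTensor.add_tmul, NTensor.tmul_add]

theorem tri_add_right (f : RDual A M) (d : D) (m m' : M) :
    tri (B := B) f d (m + m') = tri f d m + tri f d m' := by
  unfold tri; rw [NTensor.tmul_add, NTensor.tmul_add]

theorem tri_op_smul_left (b : B) (f : RDual A M) (d : D) (m : M) :
    tri (B := B) (op b • f) d m = tri f (b • d) m := by
  unfold tri; rw [NTensor.smul_tmul, NTensor.left_smul_tmul]

theorem tri_op_smul_mid (b : B) (f : RDual A M) (d : D) (m : M) :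
    tri (B := B) f (op b • d) m = tri f d (b • m) := by
  unfold tri; rw [NTensor.smul_tmul]

theorem smul_tri (a : A) (f : RDual A M) (d : D) (m : M) :
    a • tri (B := B) f d m = tri (a • f) d m := rfl

theorem op_smul_tri (a : A) (f : RDual A M) (d : D) (m : M) :
    op a • tri (B := B) f d m = tri f d (op a • m) := rfl

/-- Additive maps on `M^* ⊗_B D ⊗_B M` agree if they agree on all `f ⊗ d ⊗ m`. -/
theorem hom_ext {P : Type*} [AddCommGroup P] {F G : BaseExt B A D M →+ P}
    (h : ∀ f d m, F (tri f d m) = G (tri f d m)) : F = G := by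
  refine NTensor.hom_ext fun f t => ?_
  induction t using NTensor.induction with
  | zero => rw [NTensor.tmul_zero, map_zero, map_zero]
  | tmul d m => exact h f d m
  | add x y hx hy => rw [NTensor.tmul_add, map_add, map_add, hx, hy]

/-- Universal property of `M^* ⊗_B D ⊗_B M`. -/
def lift₃ {P : Type*} [AddCommGroup P] (F : RDual A M → D → M → P)
    (h1 : ∀ f f' d m, F (f + f') d m = F f d m + F f' d m)
    (h2 : ∀ f d d' m, F f (d + d') m = F f d m + F f d' m)
    (h3 : ∀ f d m m', F f d (m + m') = F f d m + F f d m')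
    (h4 : ∀ (b : B) f d m, F (op b • f) d m = F f (b • d) m)
    (h5 : ∀ (b : B) f d m, F f (op b • d) m = F f d (b • m)) : BaseExt B A D M →+ P :=
  NTensor.lift
    (fun f t => NTensor.lift (F f) (fun d d' m => h2 f d d' m) (fun d m m' => h3 f d m m')
      (fun b d m => h5 b f d m) t)
    (fun f f' t => by
      induction t using NTensor.induction with
      | zero => simp only [map_zero, add_zero]
      | tmul d m => exact h1 f f' d m
      | add x y hx hy => rw [map_add, map_add, map_add, hx, hy]; abel)
    (fun f t t' => map_add _ _ _)
    (fun b f t => by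
      induction t using NTensor.induction with
      | zero => simp only [map_zero, smul_zero]
      | tmul d m => exact h4 b f d m
      | add x y hx hy => rw [smul_add, map_add, map_add, hx, hy])

theorem lift₃_tri {P : Type*} [AddCommGroup P] (F : RDual A M → D → M → P) (h1 h2 h3 h4 h5)
    (f : RDual A M) (d : D) (m : M) :
    lift₃ (B := B) F h1 h2 h3 h4 h5 (tri f d m) = F f d m := rfl

/-- The map `f ⊗ d ⊗ m ↦ f (ε(d) m)`. -/
def counitHom (ε : BimodHom B B D B) : BaseExt B A D M →+ A :=
  lift₃ (fun f d m => f (ε d • m))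
    (fun f f' d m => RDual.add_apply _ _ _)
    (fun f d d' m => by rw [map_add, add_smul, map_add])
    (fun f d m m' => by rw [smul_add, map_add])
    (fun b f d m => by rw [RDual.op_smul_apply, ε.map_left, smul_eq_mul, mul_smul])
    (fun b f d m => by rw [ε.map_right, op_smul_eq_mul, mul_smul])

variable (E : DualBasis A M)

/-- The map `(f ⊗ d) ⊗ (d' ⊗ m) ↦ ∑ (f ⊗ d ⊗ e_i) ⊗_A (e_i^* ⊗ d' ⊗ m)`, for fixed `f` and `m`,
as a function of `d ⊗_B d'`. -/
def insertBasis (f : RDual A M) (m : M) :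
    NTensor B D D →+ NTensor A (BaseExt B A D M) (BaseExt B A D M) :=
  NTensor.lift (fun d d' => ∑ i, NTensor.tmul A (tri f d (E.e i)) (tri (E.f i) d' m))
    (fun d d' x => by
      simp only [tri_add_mid, NTensor.add_tmul, Finset.sum_add_distrib])
    (fun x d d' => by
      simp only [tri_add_mid, NTensor.tmul_add, Finset.sum_add_distrib])
    (fun b d d' => by
      simp only [tri_op_smul_mid, ← tri_op_smul_left]
      exact E.sum_balanced (NTensor.lift
        (fun x g => NTensor.tmul A (tri f d x) (tri g d' m))
        (fun x y g => by rw [tri_add_right, NTensor.add_tmul])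
        (fun x g h => by rw [tri_add_left, NTensor.tmul_add])
        (fun a x g => by rw [← op_smul_tri, NTensor.smul_tmul, smul_tri])) b)

theorem insertBasis_tmul (f : RDual A M) (m : M) (d d' : D) :
    insertBasis (B := B) E f m (NTensor.tmul B d d') =
      ∑ i, NTensor.tmul A (tri f d (E.e i)) (tri (E.f i) d' m) := rfl

theorem insertBasis_add_left (f f' : RDual A M) (m : M) (t : NTensor B D D) :
    insertBasis E (f + f') m t = insertBasis E f m t + insertBasis E f' m t := by
  induction t using NTensor.induction with
  | zero => simp only [map_zero, add_zero]
  | tmul d d' =>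
    simp only [insertBasis_tmul, tri_add_left, NTensor.add_tmul, Finset.sum_add_distrib]
  | add x y hx hy => rw [map_add, map_add, map_add, hx, hy]; abel

theorem insertBasis_add_right (f : RDual A M) (m m' : M) (t : NTensor B D D) :
    insertBasis E f (m + m') t = insertBasis E f m t + insertBasis E f m' t := by
  induction t using NTensor.induction with
  | zero => simp only [map_zero, add_zero]
  | tmul d d' =>
    simp only [insertBasis_tmul, tri_add_right, NTensor.tmul_add, Finset.sum_add_distrib]
  | add x y hx hy => rw [map_add, map_add, map_add, hx, hy]; abel

theorem insertBasis_op_smul_left (b : B) (f : RDual A M) (m : M) (t : NTensor B D D) :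
    insertBasis E (op b • f) m t = insertBasis E f m (b • t) := by
  induction t using NTensor.induction with
  | zero => simp only [map_zero, smul_zero]
  | tmul d d' =>
    simp only [NTensor.left_smul_tmul, insertBasis_tmul, tri_op_smul_left]
  | add x y hx hy => rw [smul_add, map_add, map_add, hx, hy]

theorem insertBasis_op_smul_right (b : B) (f : RDual A M) (m : M) (t : NTensor B D D) :
    insertBasis E f m (op b • t) = insertBasis E f (b • m) t := by
  induction t using NTensor.induction with
  | zero => simp only [map_zero, smul_zero]
  | tmul d d' =>
    simp only [NTensor.right_smul_tmul, insertBasis_tmul, tri_op_smul_mid]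
  | add x y hx hy => rw [smul_add, map_add, map_add, hx, hy]

theorem insertBasis_smul (a : A) (f : RDual A M) (m : M) (t : NTensor B D D) :
    insertBasis E (a • f) m t = a • insertBasis E f m t := by
  induction t using NTensor.induction with
  | zero => simp only [map_zero, smul_zero]
  | tmul d d' =>
    simp only [insertBasis_tmul, Finset.smul_sum, NTensor.left_smul_tmul, smul_tri]
  | add x y hx hy => rw [map_add, map_add, smul_add, hx, hy]

theorem insertBasis_op_smul (a : A) (f : RDual A M) (m : M) (t : NTensor B D D) :
    insertBasis E f (op a • m) t = op a • insertBasis E f m t := by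
  induction t using NTensor.induction with
  | zero => simp only [map_zero, smul_zero]
  | tmul d d' =>
    simp only [insertBasis_tmul, Finset.smul_sum, NTensor.right_smul_tmul, op_smul_tri]
  | add x y hx hy => rw [map_add, map_add, smul_add, hx, hy]

/-- The map `f ⊗ d ⊗ m ↦ ∑ (f ⊗ d₁ ⊗ e_i) ⊗_A (e_i^* ⊗ d₂ ⊗ m)` where `Δ(d) = ∑ d₁ ⊗ d₂`. -/
def comulHom (Δ : BimodHom B B D (NTensor B D D)) :
    BaseExt B A D M →+ NTensor A (BaseExt B A D M) (BaseExt B A D M) :=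
  lift₃ (fun f d m => insertBasis E f m (Δ d))
    (fun f f' d m => insertBasis_add_left E f f' m _)
    (fun f d d' m => by rw [map_add, map_add])
    (fun f d m m' => insertBasis_add_right E f m m' _)
    (fun b f d m => by rw [insertBasis_op_smul_left, Δ.map_left])
    (fun b f d m => by rw [Δ.map_right, insertBasis_op_smul_right])

/-- The counit of `M^* ⊗_B D ⊗_B M`. -/
def counit (ε : BimodHom B B D B) : BimodHom A A (BaseExt B A D M) A where
  toAddHom := counitHom ε
  map_left a t := DFunLike.congr_fun
    (f := (counitHom ε).comp (DistribSMul.toAddMonoidHom (BaseExt B A D M) a))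
    (g := (DistribSMul.toAddMonoidHom A a).comp (counitHom ε))
    (hom_ext fun f d m => rfl) t
  map_right a t := DFunLike.congr_fun
    (f := (counitHom ε).comp (DistribSMul.toAddMonoidHom (BaseExt B A D M) (op a)))
    (g := (DistribSMul.toAddMonoidHom A (op a)).comp (counitHom ε))
    (hom_ext fun f d m => by
      have h : f (ε d • (op a • m)) = f (ε d • m) * a := by
        rw [smul_comm, RDual.map_op_smul]
      exact h) t

/-- The comultiplication of `M^* ⊗_B D ⊗_B M`. -/
def comul (Δ : BimodHom B B D (NTensor B D D)) :
    BimodHom A A (BaseExt B A D M) (NTensor A (BaseExt B A D M) (BaseExt B A D M)) where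
  toAddHom := comulHom E Δ
  map_left a t := DFunLike.congr_fun
    (f := (comulHom E Δ).comp (DistribSMul.toAddMonoidHom (BaseExt B A D M) a))
    (g := (DistribSMul.toAddMonoidHom _ a).comp (comulHom E Δ))
    (hom_ext fun f d m => insertBasis_smul E a f m (Δ d)) t
  map_right a t := DFunLike.congr_fun
    (f := (comulHom E Δ).comp (DistribSMul.toAddMonoidHom (BaseExt B A D M) (op a)))
    (g := (DistribSMul.toAddMonoidHom _ (op a)).comp (comulHom E Δ))
    (hom_ext fun f d m => insertBasis_op_smul E a f m (Δ d)) t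

theorem counit_tri (ε : BimodHom B B D B) (f : RDual A M) (d : D) (m : M) :
    counit (A := A) ε (tri f d m) = f (ε d • m) := rfl

theorem comul_tri (Δ : BimodHom B B D (NTensor B D D)) (f : RDual A M) (d : D) (m : M) :
    comul E Δ (tri f d m) = insertBasis E f m (Δ d) := rfl

/-- The twofold insertion of the dual basis:
`d ⊗ t ↦ ∑ (f ⊗ d ⊗ e_i) ⊗_A insertBasis e_i^* m t`. -/
def insertBasisTwo (f : RDual A M) (m : M) : NTensor B D (NTensor B D D) →+
    NTensor A (BaseExt B A D M) (NTensor A (BaseExt B A D M) (BaseExt B A D M)) :=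
  NTensor.lift (fun d t => ∑ i, NTensor.tmul A (tri f d (E.e i)) (insertBasis E (E.f i) m t))
    (fun d d' t => by
      simp only [tri_add_mid, NTensor.add_tmul, Finset.sum_add_distrib])
    (fun d t t' => by
      simp only [map_add, NTensor.tmul_add, Finset.sum_add_distrib])
    (fun b d t => by
      simp only [tri_op_smul_mid, ← insertBasis_op_smul_left]
      exact E.sum_balanced (NTensor.lift
        (fun x g => NTensor.tmul A (tri f d x) (insertBasis E g m t))
        (fun x y g => by rw [tri_add_right, NTensor.add_tmul])
        (fun x g h => by rw [insertBasis_add_left, NTensor.tmul_add])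
        (fun a x g => by rw [← op_smul_tri, NTensor.smul_tmul, insertBasis_smul])) b)

theorem insertBasisTwo_tmul (f : RDual A M) (m : M) (d : D) (t : NTensor B D D) :
    insertBasisTwo (B := B) E f m (NTensor.tmul B d t) =
      ∑ i, NTensor.tmul A (tri f d (E.e i)) (insertBasis E (E.f i) m t) := rfl

theorem map_comul_left (Δ : BimodHom B B D (NTensor B D D)) (f : RDual A M) (m : M)
    (t : NTensor B D D) :
    NTensor.assoc A A (BaseExt B A D M) (BaseExt B A D M) (BaseExt B A D M)
      (NTensor.map (comul E Δ).right LinearMap.id (insertBasis E f m t)) =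
    insertBasisTwo E f m
      (NTensor.assoc B B D D D (NTensor.map Δ.right LinearMap.id t)) := by
  have key : ∀ (s : NTensor B D D) (d' : D),
      ∑ i, NTensor.assoc A A (BaseExt B A D M) (BaseExt B A D M) (BaseExt B A D M)
        (NTensor.tmul A (insertBasis E f (E.e i) s) (tri (E.f i) d' m)) =
      insertBasisTwo E f m (NTensor.assoc B B D D D (NTensor.tmul B s d')) := by
    intro s d'
    induction s using NTensor.induction with
    | zero => simp only [map_zero, NTensor.zero_tmul, Finset.sum_const_zero]
    | tmul x y =>
      simp only [NTensor.assoc_tmul, insertBasisTwo_tmul, insertBasis_tmul, NTensor.sum_tmul,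
        NTensor.tmul_sum, map_sum]
      exact Finset.sum_comm
    | add x y hx hy =>
      simp only [map_add, NTensor.add_tmul, Finset.sum_add_distrib, hx, hy]
  induction t using NTensor.induction with
  | zero => simp only [map_zero]
  | tmul d d' =>
    rw [insertBasis_tmul, map_sum, map_sum]
    exact key (Δ d) d'
  | add x y hx hy => simp only [map_add, hx, hy]

theorem map_comul_right (Δ : BimodHom B B D (NTensor B D D)) (f : RDual A M) (m : M)
    (t : NTensor B D D) :
    NTensor.map LinearMap.id (comul E Δ).left (insertBasis E f m t) =
    insertBasisTwo E f m (NTensor.map LinearMap.id Δ.left t) := by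
  induction t using NTensor.induction with
  | zero => simp only [map_zero]
  | tmul d d' =>
    rw [insertBasis_tmul, map_sum]
    rfl
  | add x y hx hy => simp only [map_add, hx, hy]

theorem map_counit_left (ε : BimodHom B B D B) (f : RDual A M) (m : M) (t : NTensor B D D) :
    NTensor.lid A (BaseExt B A D M)
      (NTensor.map (counit ε).right LinearMap.id (insertBasis E f m t)) =
    tri f (NTensor.lid B D (NTensor.map ε.right LinearMap.id t)) m := by
  induction t using NTensor.induction with
  | zero =>
    simp only [map_zero, tri, NTensor.zero_tmul, NTensor.tmul_zero]
  | tmul d d' =>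
    have h : op (ε d) • f = ∑ i, f (ε d • E.e i) • E.f i := by
      refine RDual.ext fun x => ?_
      have hs : (∑ i, f (ε d • E.e i) • E.f i) x = ∑ i, (f (ε d • E.e i) • E.f i) x :=
        LinearMap.sum_apply _ _ _
      rw [hs, RDual.op_smul_apply]
      conv_lhs => rw [← E.sum_eq x, Finset.smul_sum, map_sum]
      refine Finset.sum_congr rfl fun i _ => ?_
      rw [smul_comm, RDual.map_op_smul, RDual.smul_apply]
    have h2 : tri f (NTensor.lid B D (NTensor.map ε.right LinearMap.id (NTensor.tmul B d d'))) m =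
        tri (B := B) (op (ε d) • f) d' m := (tri_op_smul_left _ _ _ _).symm
    rw [h2, h, insertBasis_tmul, map_sum, map_sum]
    exact (NTensor.sum_tmul _ _ _).symm
  | add x y hx hy => simp only [map_add, hx, hy, tri_add_mid]

theorem map_counit_right (ε : BimodHom B B D B) (f : RDual A M) (m : M) (t : NTensor B D D) :
    NTensor.rid A (BaseExt B A D M)
      (NTensor.map LinearMap.id (counit ε).left (insertBasis E f m t)) =
    tri f (NTensor.rid B D (NTensor.map LinearMap.id ε.left t)) m := by
  induction t using NTensor.induction with
  | zero =>
    simp only [map_zero, tri, NTensor.zero_tmul, NTensor.tmul_zero]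
  | tmul d d' =>
    have h2 : tri f (NTensor.rid B D (NTensor.map LinearMap.id ε.left (NTensor.tmul B d d'))) m =
        tri (B := B) f d (ε d' • m) := tri_op_smul_mid _ _ _ _
    rw [h2, insertBasis_tmul, map_sum, map_sum]
    have h3 : ∀ i, NTensor.rid A (BaseExt B A D M) (NTensor.map LinearMap.id (counit ε).left
        (NTensor.tmul A (tri f d (E.e i)) (tri (E.f i) d' m))) =
        tri f d (op (E.f i (ε d' • m)) • E.e i) := fun i => rfl
    rw [Finset.sum_congr rfl fun i _ => h3 i]
    conv_rhs => rw [← E.sum_eq (ε d' • m)]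
    exact (map_sum (AddMonoidHom.mk' (fun x : M => tri (B := B) f d x)
      (tri_add_right f d)) _ _).symm
  | add x y hx hy => simp only [map_add, hx, hy, tri_add_mid]

end BaseExt

section BaseExtension

variable {B : Type*} {A : Type*} {D : Type*} {M : Type*} [Ring B] [Ring A]
    [AddCommGroup D] [Module B D] [Module Bᵐᵒᵖ D] [SMulCommClass B Bᵐᵒᵖ D]
    [AddCommGroup M] [Module B M] [Module Aᵐᵒᵖ M] [SMulCommClass B Aᵐᵒᵖ M]

/-- The coring structure on `M^* ⊗_B D ⊗_B M` given by a finite dual basis of `M_A`, with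
`Δ(f ⊗ d ⊗ m) = ∑ (f ⊗ d₁ ⊗ e_i) ⊗_A (e_i^* ⊗ d₂ ⊗ m)` and `ε(f ⊗ d ⊗ m) = f (ε(d) m)`. -/
def Coring.baseExtensionOf (𝔡 : Coring B D) (E : DualBasis A M) :
    Coring A (BaseExt B A D M) where
  comul := BaseExt.comul E 𝔡.comul
  counit := BaseExt.counit 𝔡.counit
  coassoc t := DFunLike.congr_fun
    (f := ((NTensor.assoc A A (BaseExt B A D M) (BaseExt B A D M)
      (BaseExt B A D M)).toAddMonoidHom.comp
        (NTensor.map (BaseExt.comul E 𝔡.comul).right LinearMap.id)).comp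
        (BaseExt.comul E 𝔡.comul).toAddHom)
    (g := (NTensor.map LinearMap.id (BaseExt.comul E 𝔡.comul).left).comp
        (BaseExt.comul E 𝔡.comul).toAddHom)
    (BaseExt.hom_ext fun f d m => by
      have h1 := BaseExt.map_comul_left E 𝔡.comul f m (𝔡.comul d)
      have h2 := BaseExt.map_comul_right E 𝔡.comul f m (𝔡.comul d)
      rw [𝔡.coassoc d] at h1
      exact h1.trans h2.symm) t
  counit_left t := DFunLike.congr_fun
    (f := ((NTensor.lid A (BaseExt B A D M)).comp
        (NTensor.map (BaseExt.counit 𝔡.counit).right LinearMap.id)).comp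
        (BaseExt.comul E 𝔡.comul).toAddHom)
    (g := AddMonoidHom.id _)
    (BaseExt.hom_ext fun f d m => by
      have h1 := BaseExt.map_counit_left E 𝔡.counit f m (𝔡.comul d)
      rw [𝔡.counit_left d] at h1
      exact h1) t
  counit_right t := DFunLike.congr_fun
    (f := ((NTensor.rid A (BaseExt B A D M)).comp
        (NTensor.map LinearMap.id (BaseExt.counit 𝔡.counit).left)).comp
        (BaseExt.comul E 𝔡.comul).toAddHom)
    (g := AddMonoidHom.id _)
    (BaseExt.hom_ext fun f d m => by
      have h1 := BaseExt.map_counit_right E 𝔡.counit f m (𝔡.comul d)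
      rw [𝔡.counit_right d] at h1
      exact h1) t

/-- The comultiplication does not depend on the dual basis. -/
theorem Coring.baseExtensionOf_eq (𝔡 : Coring B D) (E E' : DualBasis A M) :
    𝔡.baseExtensionOf E = 𝔡.baseExtensionOf E' := by
  have hT : ∀ (f : RDual A M) (m : M),
      BaseExt.insertBasis (B := B) (D := D) E f m = BaseExt.insertBasis E' f m := by
    intro f m
    refine NTensor.hom_ext fun d d' => ?_
    rw [BaseExt.insertBasis_tmul, BaseExt.insertBasis_tmul]
    have h : ∀ (G G' : DualBasis A M), ∑ i, NTensor.tmul A (G.e i) (G.f i) =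
        ∑ i, ∑ j, NTensor.tmul A (G'.e j) (G'.f j (G.e i) • G.f i) := by
      intro G G'
      refine Finset.sum_congr rfl fun i _ => ?_
      conv_lhs => rw [← G'.sum_eq (G.e i), NTensor.sum_tmul]
      exact Finset.sum_congr rfl fun j _ => NTensor.smul_tmul _ _ _
    have h' : ∀ (G G' : DualBasis A M) (j), ∑ i, G'.f j (G.e i) • G.f i = G'.f j := by
      intro G G' j
      refine RDual.ext fun x => ?_
      have hs : (∑ i, G'.f j (G.e i) • G.f i) x = ∑ i, (G'.f j (G.e i) • G.f i) x :=
        LinearMap.sum_apply _ _ _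
      rw [hs]
      conv_rhs => rw [← G.sum_eq x, map_sum]
      refine Finset.sum_congr rfl fun i _ => ?_
      rw [RDual.map_op_smul, RDual.smul_apply]
    have hE : ∑ i, NTensor.tmul A (E.e i) (E.f i) = ∑ j, NTensor.tmul A (E'.e j) (E'.f j) := by
      rw [h E E', Finset.sum_comm]
      refine Finset.sum_congr rfl fun j _ => ?_
      rw [← NTensor.tmul_sum, h' E E' j]
    have hF := congrArg (NTensor.lift
        (fun x g => NTensor.tmul A (BaseExt.tri (B := B) f d x) (BaseExt.tri (B := B) g d' m))
        (fun x y g => by rw [BaseExt.tri_add_right, NTensor.add_tmul])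
        (fun x g h => by rw [BaseExt.tri_add_left, NTensor.tmul_add])
        (fun a x g => by
          rw [← BaseExt.op_smul_tri, NTensor.smul_tmul, BaseExt.smul_tri])) hE
    rw [map_sum, map_sum] at hF
    exact hF
  have hC : BaseExt.comul E 𝔡.comul = BaseExt.comul E' 𝔡.comul := by
    have : (BaseExt.comul E 𝔡.comul).toAddHom = (BaseExt.comul E' 𝔡.comul).toAddHom :=
      BaseExt.hom_ext fun f d m => DFunLike.congr_fun (hT f m) (𝔡.comul d)
    unfold BaseExt.comul at this ⊢
    congr
  unfold Coring.baseExtensionOf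
  congr

variable (A M) in
/-- The base ring extension `M[D] = M^* ⊗_B D ⊗_B M` of a `B`-coring `D` by a `(B, A)`-bimodule `M`
that is finitely generated and projective as a right `A`-module. -/
noncomputable def Coring.baseExtension [Module.Finite Aᵐᵒᵖ M] [Module.Projective Aᵐᵒᵖ M]
    (𝔡 : Coring B D) : Coring A (BaseExt B A D M) :=
  𝔡.baseExtensionOf (dualBasis A M)

end BaseExtension

/-!
Write `M` for the bimodule, `(e_i, e_i^*)` for a dual basis of `M_A` and `C = M^* ⊗_B D ⊗_B M`.

The coseparability and Frobenius statements rest on one construction, `BaseExt.contract`: a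
`B`-bimodule map `ω : M ⊗_A M^* → B` contracts the two inner factors of `C ⊗_A C` and gives
`C ⊗_A C → M^* ⊗_B (D ⊗_B D) ⊗_B M`. A structure map on `D ⊗_B D` can then be applied in the middle.

* Coseparability. If `∑ x_k ⊗ g_k` is the `B`-central element of `M ⊗_A ^*M` that separability of
  `M` provides, then `ω(m ⊗ f) = ∑ g_k(m f(x_k))` maps `∑ e_i ⊗ e_i^*` to `1`
  (`IsSeparableBimodule.exists_retraction`), so contraction is a retraction of the insertion of the
  dual basis. Followed by the bicolinear retraction of `Δ_D`, it splits the comultiplication of `C`.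

* Cosplitness. As `M ≃ ^*(M^*)`, the bimodule `M^*` is separable if and only if the evaluation
  `M^* ⊗_B M → A` is a split epimorphism. Bimodule maps over `A` in both directions between
  `M^* ⊗_B M` and `C` commute with the maps to `A`: `f ⊗ m ↦ f ⊗ c ⊗ m`, for a `B`-central `c` with
  `ε_D(c) = 1`, and `f ⊗ d ⊗ m ↦ f ⊗ ε_D(d) m`.

* Frobenius corings. The forgetful functor has the right adjoint `- ⊗_A C`, so a coring is
  Frobenius if and only if `- ⊗_A C` is also a left adjoint of it. The unit and counit of such an
  adjunction are determined by naturality from an `A`-central element `z` and a pairing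
  `π : C ⊗_A C → A` (`Coring.FrobeniusSystem`), which can be transported along `M` by hand: an
  isomorphism `γ : M^* ≃ ^*M` gives the form `ω(m ⊗ f) = γ(f)(m)`, and a dual basis of `_B M` gives
  elements `t_j` and `k_j` dual to each other for `ω`. Then `∑ k_j ⊗ z ⊗ t_j` and the contraction
  followed by `f ⊗ (d ⊗ d') ⊗ m ↦ f(π(d ⊗ d') m)` form a Frobenius system of `C`.
-/

/-! ### Contraction of the inner pair of bimodules -/

namespace BaseExt

variable {B : Type*} {A : Type*} {D : Type*} {M : Type*} [Ring B] [Ring A]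
    [AddCommGroup D] [Module B D] [Module Bᵐᵒᵖ D] [SMulCommClass B Bᵐᵒᵖ D]
    [AddCommGroup M] [Module B M] [Module Aᵐᵒᵖ M] [SMulCommClass B Aᵐᵒᵖ M]

/-- Additive maps on `M[D] ⊗_A M[D]` agree if they agree on all `(f ⊗ d ⊗ m) ⊗ (f' ⊗ d' ⊗ m')`. -/
theorem hom_ext₂ {P : Type*} [AddCommGroup P]
    {F G : NTensor A (BaseExt B A D M) (BaseExt B A D M) →+ P}
    (h : ∀ f d m f' d' m', F (NTensor.tmul A (tri f d m) (tri f' d' m')) =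
      G (NTensor.tmul A (tri f d m) (tri f' d' m'))) : F = G := by
  refine NTensor.hom_ext fun x y => ?_
  refine DFunLike.congr_fun
    (f := F.comp (AddMonoidHom.mk' (fun x => NTensor.tmul A x y)
      fun x x' => NTensor.add_tmul x x' y))
    (g := G.comp (AddMonoidHom.mk' (fun x => NTensor.tmul A x y)
      fun x x' => NTensor.add_tmul x x' y)) (hom_ext fun f d m => ?_) x
  exact DFunLike.congr_fun
    (f := F.comp (AddMonoidHom.mk' (fun y => NTensor.tmul A (tri f d m) y)
      fun y y' => NTensor.tmul_add _ y y'))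
    (g := G.comp (AddMonoidHom.mk' (fun y => NTensor.tmul A (tri f d m) y)
      fun y y' => NTensor.tmul_add _ y y')) (hom_ext fun f' d' m' => h f d m f' d' m') y

theorem tri_zero_mid (f : RDual A M) (m : M) : tri (B := B) f (0 : D) m = 0 := by
  unfold tri; rw [NTensor.zero_tmul, NTensor.tmul_zero]

variable (ω : BimodHom B B (NTensor A M (RDual A M)) B)

/-- For a fixed left factor `f ⊗ d ⊗ m`, the map
`f' ⊗ d' ⊗ m' ↦ f ⊗ (d ω(m ⊗ f') ⊗ d') ⊗ m'`. -/
def contractRight (f : RDual A M) (d : D) (m : M) :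
    BaseExt B A D M →+ BaseExt B A (NTensor B D D) M :=
  lift₃ (fun f' d' m' =>
      tri f (NTensor.tmul B (op (ω (NTensor.tmul A m f')) • d) d') m')
    (fun f' f'' d' m' => by
      rw [NTensor.tmul_add, map_add, op_add, add_smul, NTensor.add_tmul, tri_add_mid])
    (fun f' d' d'' m' => by rw [NTensor.tmul_add, tri_add_mid])
    (fun f' d' m' m'' => tri_add_right _ _ _ _)
    (fun b f' d' m' => by
      rw [← NTensor.right_smul_tmul, ω.map_right, op_smul_eq_mul, op_mul, mul_smul,
        NTensor.smul_tmul])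
    (fun b f' d' m' => by rw [← NTensor.right_smul_tmul, tri_op_smul_mid])

theorem contractRight_tri (f : RDual A M) (d : D) (m : M) (f' : RDual A M) (d' : D) (m' : M) :
    contractRight ω f d m (tri f' d' m') =
      tri f (NTensor.tmul B (op (ω (NTensor.tmul A m f')) • d) d') m' := rfl

/-- The map `x ↦ (y ↦ contraction of x ⊗ y)`. -/
def contractCurry :
    BaseExt B A D M →+ (BaseExt B A D M →+ BaseExt B A (NTensor B D D) M) :=
  lift₃ (fun f d m => contractRight ω f d m)
    (fun f f' d m => hom_ext fun _ _ _ => tri_add_left _ _ _ _)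
    (fun f d d' m => hom_ext fun f' e m' => by
      rw [AddMonoidHom.add_apply, contractRight_tri, contractRight_tri, contractRight_tri,
        smul_add, NTensor.add_tmul, tri_add_mid])
    (fun f d m m' => hom_ext fun f' e n => by
      rw [AddMonoidHom.add_apply, contractRight_tri, contractRight_tri, contractRight_tri,
        NTensor.add_tmul, map_add, op_add, add_smul, NTensor.add_tmul, tri_add_mid])
    (fun b f d m => hom_ext fun f' e n => by
      rw [contractRight_tri, contractRight_tri, tri_op_smul_left, NTensor.left_smul_tmul,
        smul_comm])
    (fun b f d m => hom_ext fun f' e n => by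
      rw [contractRight_tri, contractRight_tri, ← NTensor.left_smul_tmul b m f', ω.map_left,
        smul_eq_mul, op_mul, mul_smul])

/-- The additive map underlying `contract`. -/
def contractHom : NTensor A (BaseExt B A D M) (BaseExt B A D M) →+
    BaseExt B A (NTensor B D D) M :=
  NTensor.lift (fun x y => contractCurry ω x y)
    (fun x x' y => by rw [map_add, AddMonoidHom.add_apply])
    (fun x y y' => map_add _ _ _)
    (fun a x y => by
      refine DFunLike.congr_fun (f := (contractCurry ω).comp
          (DistribSMul.toAddMonoidHom (BaseExt B A D M) (op a)))
        (g := ((AddMonoidHom.compHom).flip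
          (DistribSMul.toAddMonoidHom (BaseExt B A D M) a)).comp (contractCurry ω))
        (hom_ext fun f d m => hom_ext fun f' d' m' => ?_) x |> fun h => DFunLike.congr_fun h y
      change tri f (NTensor.tmul B (op (ω (NTensor.tmul A (op a • m) f')) • d) d') m' =
        tri f (NTensor.tmul B (op (ω (NTensor.tmul A m (a • f'))) • d) d') m'
      rw [NTensor.smul_tmul a m f'])

/-- A `B`-bimodule map `ω : M ⊗_A M^* → B` contracts the two inner factors of `M[D] ⊗_A M[D]`:
`(f ⊗ d ⊗ m) ⊗ (f' ⊗ d' ⊗ m') ↦ f ⊗ (d ω(m ⊗ f') ⊗ d') ⊗ m'`, with values in `M[D ⊗_B D]`. -/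
def contract : BimodHom A A (NTensor A (BaseExt B A D M) (BaseExt B A D M))
    (BaseExt B A (NTensor B D D) M) where
  toAddHom := contractHom ω
  map_left a t := DFunLike.congr_fun
    (f := (contractHom ω).comp
      (DistribSMul.toAddMonoidHom (NTensor A (BaseExt B A D M) (BaseExt B A D M)) a))
    (g := (DistribSMul.toAddMonoidHom _ a).comp (contractHom ω))
    (hom_ext₂ fun _ _ _ _ _ _ => rfl) t
  map_right a t := DFunLike.congr_fun
    (f := (contractHom ω).comp
      (DistribSMul.toAddMonoidHom (NTensor A (BaseExt B A D M) (BaseExt B A D M)) (op a)))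
    (g := (DistribSMul.toAddMonoidHom _ (op a)).comp (contractHom ω))
    (hom_ext₂ fun _ _ _ _ _ _ => rfl) t

theorem contract_tmul_tri (f : RDual A M) (d : D) (m : M) (f' : RDual A M) (d' : D) (m' : M) :
    contract ω (NTensor.tmul A (tri f d m) (tri f' d' m')) =
      tri f (NTensor.tmul B (op (ω (NTensor.tmul A m f')) • d) d') m' := rfl

variable {D' : Type*} [AddCommGroup D'] [Module B D'] [Module Bᵐᵒᵖ D'] [SMulCommClass B Bᵐᵒᵖ D']

variable (A M) in
/-- The additive map underlying `mapMid`. -/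
def mapMidHom (φ : BimodHom B B D D') : BaseExt B A D M →+ BaseExt B A D' M :=
  lift₃ (fun f d m => tri f (φ d) m)
    (fun f f' d m => tri_add_left _ _ _ _)
    (fun f d d' m => by rw [map_add, tri_add_mid])
    (fun f d m m' => tri_add_right _ _ _ _)
    (fun b f d m => by rw [φ.map_left, tri_op_smul_left])
    (fun b f d m => by rw [φ.map_right, tri_op_smul_mid])

variable (A M) in
/-- Functoriality of `M[D] = M^* ⊗_B D ⊗_B M` in the bimodule `D`. -/
def mapMid (φ : BimodHom B B D D') : BimodHom A A (BaseExt B A D M) (BaseExt B A D' M) where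
  toAddHom := mapMidHom A M φ
  map_left a t := DFunLike.congr_fun
    (f := (mapMidHom A M φ).comp
      (DistribSMul.toAddMonoidHom (BaseExt B A D M) a))
    (g := (DistribSMul.toAddMonoidHom _ a).comp (mapMidHom A M φ))
    (hom_ext fun _ _ _ => rfl) t
  map_right a t := DFunLike.congr_fun
    (f := (mapMidHom A M φ).comp
      (DistribSMul.toAddMonoidHom (BaseExt B A D M) (op a)))
    (g := (DistribSMul.toAddMonoidHom _ (op a)).comp (mapMidHom A M φ))
    (hom_ext fun _ _ _ => rfl) t

theorem mapMid_tri (φ : BimodHom B B D D') (f : RDual A M) (d : D) (m : M) :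
    mapMid A M φ (tri f d m) = tri f (φ d) m := rfl

end BaseExt

namespace BimodHom

variable {R S M N P : Type*} [Ring R] [Ring S]
    [AddCommGroup M] [AddCommGroup N] [AddCommGroup P] [Module R M] [Module Sᵐᵒᵖ M] [Module R N]
    [Module Sᵐᵒᵖ N] [Module R P] [Module Sᵐᵒᵖ P]

/-- Composition of bimodule maps. -/
def comp (g : BimodHom R S N P) (f : BimodHom R S M N) : BimodHom R S M P where
  toAddHom := g.toAddHom.comp f.toAddHom
  map_left r m := (congrArg g (f.map_left r m)).trans (g.map_left r _)
  map_right s m := (congrArg g (f.map_right s m)).trans (g.map_right s _)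

theorem comp_apply (g : BimodHom R S N P) (f : BimodHom R S M N) (m : M) :
    g.comp f m = g (f m) := rfl

end BimodHom

/-! ### Coseparability of the base ring extension -/

section Coseparable

variable {B : Type*} {A : Type*} {D : Type*} {M : Type*} [Ring B] [Ring A]
    [AddCommGroup D] [Module B D] [Module Bᵐᵒᵖ D] [SMulCommClass B Bᵐᵒᵖ D]
    [AddCommGroup M] [Module B M] [Module Aᵐᵒᵖ M] [SMulCommClass B Aᵐᵒᵖ M]

/-- The map `x ⊗ g ↦ g(m f(x))`, for fixed `m` and `f`. -/
def evalRankOne (m : M) (f : RDual A M) : NTensor A M (LDual B M) →+ B :=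
  NTensor.lift (fun x g => g (op (f x) • m))
    (fun x x' g => by rw [map_add, op_add, add_smul, map_add])
    (fun x g g' => LDual.add_apply _ _ _)
    (fun a x g => by rw [RDual.map_op_smul, op_mul, mul_smul, LDual.smul_apply])

theorem evalRankOne_tmul (m : M) (f : RDual A M) (x : M) (g : LDual B M) :
    evalRankOne m f (NTensor.tmul A x g) = g (op (f x) • m) := rfl

/-- The map `m ⊗ f ↦ ∑ g(m f(x))` defined by an element `t = ∑ x ⊗ g` of `M ⊗_A ^*M`. Through
`M ⊗_A M^* ≃ End(M_A)` it is `T ↦ ∑ g(T x)`. -/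
def traceHom (t : NTensor A M (LDual B M)) : NTensor A M (RDual A M) →+ B :=
  NTensor.lift
    (fun m f => evalRankOne m f t)
    (fun m m' f => by
      induction t using NTensor.induction with
      | zero => simp only [map_zero, add_zero]
      | tmul x g => rw [evalRankOne_tmul, evalRankOne_tmul, evalRankOne_tmul, smul_add, map_add]
      | add s t hs ht => rw [map_add, map_add, map_add, hs, ht]; abel)
    (fun m f f' => by
      induction t using NTensor.induction with
      | zero => simp only [map_zero, add_zero]
      | tmul x g =>
        rw [evalRankOne_tmul, evalRankOne_tmul, evalRankOne_tmul, RDual.add_apply, op_add,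
          add_smul, map_add]
      | add s t hs ht => rw [map_add, map_add, map_add, hs, ht]; abel)
    (fun a m f => by
      congr 1
      refine NTensor.hom_ext fun x g => ?_
      rw [evalRankOne_tmul, evalRankOne_tmul, RDual.smul_apply, op_mul, mul_smul])

theorem traceHom_tmul (x : M) (g : LDual B M) (m : M) (f : RDual A M) :
    traceHom (NTensor.tmul A x g) (NTensor.tmul A m f) = g (op (f x) • m) := rfl

theorem traceHom_add (s t : NTensor A M (LDual B M)) :
    traceHom (s + t) = traceHom s + traceHom t :=
  NTensor.hom_ext fun m f => (evalRankOne m f).map_add s t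

theorem traceHom_zero : traceHom (0 : NTensor A M (LDual B M)) = 0 := by
  have h := traceHom_add (0 : NTensor A M (LDual B M)) 0
  rw [add_zero] at h
  exact left_eq_add.mp h

theorem traceHom_smul_left (t : NTensor A M (LDual B M)) (b : B) (w : NTensor A M (RDual A M)) :
    traceHom t (b • w) = b * traceHom t w := by
  induction w using NTensor.induction with
  | zero => simp only [map_zero, smul_zero, mul_zero]
  | tmul m f =>
    induction t using NTensor.induction with
    | zero => simp only [traceHom_zero, AddMonoidHom.zero_apply, mul_zero]
    | tmul x g =>
      rw [NTensor.left_smul_tmul, traceHom_tmul, traceHom_tmul, ← smul_comm, map_smul, smul_eq_mul]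
    | add s t hs ht => rw [traceHom_add, AddMonoidHom.add_apply, AddMonoidHom.add_apply, hs, ht,
        mul_add]
  | add v w hv hw => rw [smul_add, map_add, map_add, hv, hw, mul_add]

theorem traceHom_smul (t : NTensor A M (LDual B M)) (b : B) (w : NTensor A M (RDual A M)) :
    traceHom t (op b • w) = traceHom (b • t) w := by
  induction w using NTensor.induction with
  | zero => simp only [map_zero, smul_zero]
  | tmul m f =>
    induction t using NTensor.induction with
    | zero => simp only [traceHom_zero, AddMonoidHom.zero_apply, smul_zero]
    | tmul x g => rfl
    | add s t hs ht => rw [smul_add, traceHom_add, traceHom_add, AddMonoidHom.add_apply,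
        AddMonoidHom.add_apply, hs, ht]
  | add v w hv hw => rw [smul_add, map_add, map_add, hv, hw]

theorem traceHom_op_smul (t : NTensor A M (LDual B M)) (b : B) (w : NTensor A M (RDual A M)) :
    traceHom (op b • t) w = traceHom t w * b := by
  induction w using NTensor.induction with
  | zero => simp only [map_zero, zero_mul]
  | tmul m f =>
    induction t using NTensor.induction with
    | zero => simp only [traceHom_zero, AddMonoidHom.zero_apply, smul_zero, zero_mul]
    | tmul x g => rfl
    | add s t hs ht => rw [smul_add, traceHom_add, traceHom_add, AddMonoidHom.add_apply,
        AddMonoidHom.add_apply, hs, ht, add_mul]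
  | add v w hv hw => rw [map_add, map_add, hv, hw, add_mul]

theorem traceHom_dualBasis (E : DualBasis A M) (t : NTensor A M (LDual B M)) :
    traceHom t (∑ i, NTensor.tmul A (E.e i) (E.f i)) = evalBimod B A M t := by
  induction t using NTensor.induction with
  | zero => rw [traceHom_zero, map_zero, AddMonoidHom.zero_apply]
  | tmul x g =>
    rw [map_sum]
    simp only [traceHom_tmul]
    rw [← map_sum, E.sum_eq]
    rfl
  | add s t hs ht => rw [traceHom_add, AddMonoidHom.add_apply, hs, ht, map_add]

/-- If `M` is separable, then `B → End(M_A) ≃ M ⊗_A M^*` is a split monomorphism of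
`B`-bimodules. -/
theorem IsSeparableBimodule.exists_retraction (E : DualBasis A M) (h : IsSeparableBimodule B A M) :
    ∃ ω : BimodHom B B (NTensor A M (RDual A M)) B,
      ω (∑ i, NTensor.tmul A (E.e i) (E.f i)) = 1 := by
  obtain ⟨σ, hσ⟩ := h
  -- `σ 1` commutes with `B`
  have hc : ∀ b : B, b • σ 1 = op b • σ 1 := fun b => by
    rw [← σ.map_left, ← σ.map_right, smul_eq_mul, op_smul_eq_mul, mul_one, one_mul]
  exact ⟨⟨traceHom (σ 1), fun b w => traceHom_smul_left _ b w, fun b w => by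
    rw [traceHom_smul, hc, traceHom_op_smul, op_smul_eq_mul]⟩,
    (traceHom_dualBasis E _).trans (hσ 1)⟩

open BaseExt in
/-- If `∑ e_i ⊗ e_i^* ↦ 1` splits the unit of `End(M_A)`, then contraction splits the insertion of
the dual basis. -/
theorem BaseExt.contract_insertBasis (E : DualBasis A M)
    (ω : BimodHom B B (NTensor A M (RDual A M)) B)
    (hω : ω (∑ i, NTensor.tmul A (E.e i) (E.f i)) = 1) (f : RDual A M) (m : M)
    (t : NTensor B D D) : contract ω (insertBasis E f m t) = tri f t m := by
  induction t using NTensor.induction with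
  | zero => rw [map_zero, map_zero, tri_zero_mid]
  | tmul d d' =>
    rw [insertBasis_tmul, map_sum]
    simp only [contract_tmul_tri]
    have h := congrArg (AddMonoidHom.mk' (fun b : B =>
      tri (B := B) f (NTensor.tmul B (op b • d) d') m) fun b b' => by
        rw [op_add, add_smul, NTensor.add_tmul, tri_add_mid]) hω
    rw [map_sum, map_sum] at h
    refine h.trans ?_
    rw [AddMonoidHom.mk'_apply, op_one, one_smul]
  | add x y hx hy => rw [map_add, map_add, hx, hy, tri_add_mid]

open BaseExt in
/-- The retraction is contraction followed by the bicolinear retraction `ν` of `Δ_D`; its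
colinearity on both sides is that of `ν`, since contraction does not touch the outer factors. -/
theorem Coring.IsCoseparable.baseExtensionOf {𝔡 : Coring B D} (h : 𝔡.IsCoseparable)
    (E : DualBasis A M) (hM : IsSeparableBimodule B A M) :
    (𝔡.baseExtensionOf E).IsCoseparable := by
  obtain ⟨ω, hω⟩ := hM.exists_retraction E
  obtain ⟨ν, hν, hl, hr⟩ := h
  refine ⟨(mapMid A M ν).comp (contract ω), ?_, ?_, ?_⟩
  · refine DFunLike.congr_fun
      (f := ((mapMid A M ν).comp (contract ω)).toAddHom.comp (BaseExt.comul E 𝔡.comul).toAddHom)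
      (g := AddMonoidHom.id _) (hom_ext fun f d m => ?_)
    change mapMid A M ν (contract ω (insertBasis E f m (𝔡.comul d))) = tri f d m
    rw [contract_insertBasis E ω hω, mapMid_tri, hν]
  · intro t
    refine DFunLike.congr_fun
      (f := (BaseExt.comul E 𝔡.comul).toAddHom.comp ((mapMid A M ν).comp (contract ω)).toAddHom)
      (g := (NTensor.map LinearMap.id ((mapMid A M ν).comp (contract ω)).left).comp
        ((NTensor.assoc A A _ _ _).toAddMonoidHom.comp
          (NTensor.map (BaseExt.comul E 𝔡.comul).right LinearMap.id)))
      (hom_ext₂ fun f d m f' d' m' => ?_) t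
    have key : ∀ s : NTensor B D D,
        NTensor.map LinearMap.id ((mapMid A M ν).comp (contract ω)).left
          (NTensor.assoc A A _ _ _ (NTensor.tmul A (insertBasis E f m s) (tri f' d' m'))) =
        insertBasis E f m' (NTensor.map LinearMap.id ν.left (NTensor.assoc B B D D D
          (NTensor.tmul B (op (ω (NTensor.tmul A m f')) • s) d'))) := fun s => by
      induction s using NTensor.induction with
      | zero => simp only [map_zero, NTensor.zero_tmul, smul_zero]
      | tmul x y =>
        rw [insertBasis_tmul, NTensor.sum_tmul, map_sum, map_sum]
        rfl
      | add x y hx hy => simp only [map_add, NTensor.add_tmul, smul_add, hx, hy]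
    refine Eq.trans ?_ (key (𝔡.comul d)).symm
    change insertBasis E f m' (𝔡.comul (ν _)) = _
    rw [hl, NTensor.map_tmul, ← 𝔡.comul.map_right]
    rfl
  · intro t
    refine DFunLike.congr_fun
      (f := (BaseExt.comul E 𝔡.comul).toAddHom.comp ((mapMid A M ν).comp (contract ω)).toAddHom)
      (g := (NTensor.map ((mapMid A M ν).comp (contract ω)).right LinearMap.id).comp
        ((NTensor.assoc A A _ _ _).symm.toAddMonoidHom.comp
          (NTensor.map LinearMap.id (BaseExt.comul E 𝔡.comul).left)))
      (hom_ext₂ fun f d m f' d' m' => ?_) t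
    have key : ∀ s : NTensor B D D,
        NTensor.map ((mapMid A M ν).comp (contract ω)).right LinearMap.id
          ((NTensor.assoc A A _ _ _).symm (NTensor.tmul A (tri f d m) (insertBasis E f' m' s))) =
        insertBasis E f m' (NTensor.map ν.right LinearMap.id ((NTensor.assoc B B D D D).symm
          (NTensor.tmul B (op (ω (NTensor.tmul A m f')) • d) s))) := fun s => by
      induction s using NTensor.induction with
      | zero => simp only [map_zero, NTensor.tmul_zero]
      | tmul x y =>
        rw [insertBasis_tmul, NTensor.tmul_sum, map_sum, map_sum]
        rfl
      | add x y hx hy => simp only [map_add, NTensor.tmul_add, hx, hy]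
    refine Eq.trans ?_ (key (𝔡.comul d')).symm
    change insertBasis E f m' (𝔡.comul (ν _)) = _
    rw [hr, NTensor.map_tmul]
    rfl

end Coseparable

/-! ### Cosplit base ring extensions -/

section Cosplit

variable {B : Type*} {A : Type*} {D : Type*} {M : Type*} [Ring B] [Ring A]
    [AddCommGroup D] [Module B D] [Module Bᵐᵒᵖ D] [SMulCommClass B Bᵐᵒᵖ D]
    [AddCommGroup M] [Module B M] [Module Aᵐᵒᵖ M] [SMulCommClass B Aᵐᵒᵖ M]

theorem RDual.sum_apply {ι : Type*} (s : Finset ι) (g : ι → RDual A M) (m : M) :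
    (∑ i ∈ s, g i) m = ∑ i ∈ s, g i m :=
  LinearMap.sum_apply _ _ _

theorem DualBasis.sum_smul_eq (E : DualBasis A M) (f : RDual A M) :
    ∑ i, f (E.e i) • E.f i = f := by
  refine RDual.ext fun m => ?_
  rw [RDual.sum_apply]
  conv_rhs => rw [← E.sum_eq m, map_sum]
  refine Finset.sum_congr rfl fun i _ => ?_
  rw [RDual.map_op_smul, RDual.smul_apply]

variable (A) in
/-- The evaluation `M → ^*(M^*)`. -/
def RDual.eval (m : M) : LDual A (RDual A M) :=
  ({ toFun := fun f => f m
     map_add' := fun _ _ => rfl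
     map_smul' := fun _ _ => rfl } : RDual A M →ₗ[A] A)

theorem RDual.eval_add (m m' : M) : RDual.eval A (m + m') = RDual.eval A m + RDual.eval A m' :=
  LDual.ext fun f => map_add f m m'

theorem RDual.eval_smul (b : B) (m : M) : RDual.eval A (b • m) = b • RDual.eval A m := rfl

theorem RDual.eval_op_smul (a : A) (m : M) : RDual.eval A (op a • m) = op a • RDual.eval A m :=
  LDual.ext fun f => RDual.map_op_smul f a m

/-- The inverse `g ↦ ∑ e_i g(e_i^*)` of the evaluation `M → ^*(M^*)`. -/
def DualBasis.unbidual (E : DualBasis A M) : LDual A (RDual A M) →+ M where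
  toFun g := ∑ i, op (g (E.f i)) • E.e i
  map_zero' := Finset.sum_eq_zero fun i _ => by
    change op (0 : A) • E.e i = 0
    rw [op_zero, zero_smul]
  map_add' g g' := by
    simp only [LDual.add_apply, op_add, add_smul, Finset.sum_add_distrib]

theorem DualBasis.apply_unbidual (E : DualBasis A M) (f : RDual A M) (g : LDual A (RDual A M)) :
    f (E.unbidual g) = g f := by
  conv_rhs => rw [← E.sum_smul_eq f, map_sum]
  change f (∑ i, op (g (E.f i)) • E.e i) = _
  rw [map_sum]
  refine Finset.sum_congr rfl fun i _ => ?_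
  rw [RDual.map_op_smul, map_smul, smul_eq_mul]

/-- A finitely generated projective module is torsionless: its functionals separate points. -/
theorem DualBasis.ext_apply (E : DualBasis A M) {m m' : M} (h : ∀ f : RDual A M, f m = f m') :
    m = m' := by
  rw [← E.sum_eq m, ← E.sum_eq m']
  exact Finset.sum_congr rfl fun i _ => by rw [h]

theorem DualBasis.unbidual_smul (E : DualBasis A M) (b : B) (g : LDual A (RDual A M)) :
    E.unbidual (b • g) = b • E.unbidual g :=
  E.ext_apply fun f => by
    rw [E.apply_unbidual, ← RDual.op_smul_apply, E.apply_unbidual, LDual.smul_apply]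

theorem DualBasis.unbidual_op_smul (E : DualBasis A M) (a : A) (g : LDual A (RDual A M)) :
    E.unbidual (op a • g) = op a • E.unbidual g :=
  E.ext_apply fun f => by
    rw [E.apply_unbidual, RDual.map_op_smul, E.apply_unbidual, LDual.op_smul_apply]

open BaseExt in
/-- The additive map underlying `insertCentral`. -/
def BaseExt.insertCentralHom (E : DualBasis A M) (c : D) (hc : ∀ b : B, b • c = op b • c) :
    NTensor B (RDual A M) (LDual A (RDual A M)) →+ BaseExt B A D M :=
  NTensor.lift (fun f g => tri f c (E.unbidual g))
    (fun f f' g => tri_add_left _ _ _ _)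
    (fun f g g' => by rw [map_add, tri_add_right])
    (fun b f g => by rw [tri_op_smul_left, hc, tri_op_smul_mid, E.unbidual_smul])

open BaseExt in
/-- A `B`-central element `c` of `D` gives a bimodule map
`M^* ⊗_B ^*(M^*) ≃ M^* ⊗_B M → M^* ⊗_B D ⊗_B M`, `f ⊗ m ↦ f ⊗ c ⊗ m`. -/
def BaseExt.insertCentral (E : DualBasis A M) (c : D) (hc : ∀ b : B, b • c = op b • c) :
    BimodHom A A (NTensor B (RDual A M) (LDual A (RDual A M))) (BaseExt B A D M) where
  toAddHom := insertCentralHom E c hc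
  map_left a t := DFunLike.congr_fun
    (f := (insertCentralHom E c hc).comp (DistribSMul.toAddMonoidHom _ a))
    (g := (DistribSMul.toAddMonoidHom _ a).comp (insertCentralHom E c hc))
    (NTensor.hom_ext fun _ _ => rfl) t
  map_right a t := DFunLike.congr_fun
    (f := (insertCentralHom E c hc).comp (DistribSMul.toAddMonoidHom _ (op a)))
    (g := (DistribSMul.toAddMonoidHom _ (op a)).comp (insertCentralHom E c hc))
    (NTensor.hom_ext fun f g => congrArg (fun m => tri f c m) (E.unbidual_op_smul a g)) t

variable (A M) in
open BaseExt in
/-- The additive map underlying `forgetMid`. -/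
def BaseExt.forgetMidHom (ε : BimodHom B B D B) :
    BaseExt B A D M →+ NTensor B (RDual A M) (LDual A (RDual A M)) :=
  lift₃ (fun f d m => NTensor.tmul B f (RDual.eval A (ε d • m)))
    (fun f f' d m => NTensor.add_tmul _ _ _)
    (fun f d d' m => by rw [map_add, add_smul, RDual.eval_add, NTensor.tmul_add])
    (fun f d m m' => by rw [smul_add, RDual.eval_add, NTensor.tmul_add])
    (fun b f d m => by
      rw [ε.map_left, smul_eq_mul, mul_smul, NTensor.smul_tmul, ← RDual.eval_smul])
    (fun b f d m => by rw [ε.map_right, op_smul_eq_mul, mul_smul])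

variable (A M) in
open BaseExt in
/-- The bimodule map `M^* ⊗_B D ⊗_B M → M^* ⊗_B ^*(M^*)` given by
`f ⊗ d ⊗ m ↦ f ⊗ ε(d) m`. -/
def BaseExt.forgetMid (ε : BimodHom B B D B) :
    BimodHom A A (BaseExt B A D M) (NTensor B (RDual A M) (LDual A (RDual A M))) where
  toAddHom := forgetMidHom A M ε
  map_left a t := DFunLike.congr_fun
    (f := (forgetMidHom A M ε).comp (DistribSMul.toAddMonoidHom _ a))
    (g := (DistribSMul.toAddMonoidHom _ a).comp (forgetMidHom A M ε))
    (hom_ext fun _ _ _ => rfl) t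
  map_right a t := DFunLike.congr_fun
    (f := (forgetMidHom A M ε).comp (DistribSMul.toAddMonoidHom _ (op a)))
    (g := (DistribSMul.toAddMonoidHom _ (op a)).comp (forgetMidHom A M ε))
    (hom_ext fun f d m => by
      change NTensor.tmul B f (RDual.eval A (ε d • (op a • m))) =
        NTensor.tmul B f (op a • RDual.eval A (ε d • m))
      rw [smul_comm, RDual.eval_op_smul]) t

open BaseExt in
theorem Coring.IsCosplit.baseExtensionOf {𝔡 : Coring B D} (h : 𝔡.IsCosplit)
    (E : DualBasis A M) (hM : IsSeparableBimodule A B (RDual A M)) :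
    (𝔡.baseExtensionOf E).IsCosplit := by
  obtain ⟨τ, hτ⟩ := h
  obtain ⟨σ, hσ⟩ := hM
  -- `τ 1` commutes with `B`
  have hc : ∀ b : B, b • τ 1 = op b • τ 1 := fun b => by
    rw [← τ.map_left, ← τ.map_right, smul_eq_mul, op_smul_eq_mul, mul_one, one_mul]
  refine ⟨(insertCentral E (τ 1) hc).comp σ, fun a => ?_⟩
  refine Eq.trans ?_ (hσ a)
  refine DFunLike.congr_fun
    (f := (BaseExt.counit 𝔡.counit).toAddHom.comp (insertCentral E (τ 1) hc).toAddHom)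
    (g := (evalBimod A B (RDual A M)).toAddHom) (NTensor.hom_ext fun f g => ?_) (σ a)
  change f (𝔡.counit (τ 1) • E.unbidual g) = g f
  rw [hτ, one_smul, E.apply_unbidual]

open BaseExt in
theorem Coring.IsCosplit.isSeparableBimodule {𝔡 : Coring B D} {E : DualBasis A M}
    (h : (𝔡.baseExtensionOf E).IsCosplit) : IsSeparableBimodule A B (RDual A M) := by
  obtain ⟨σ, hσ⟩ := h
  refine ⟨(forgetMid A M 𝔡.counit).comp σ, fun a => Eq.trans ?_ (hσ a)⟩
  exact DFunLike.congr_fun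
    (f := (evalBimod A B (RDual A M)).toAddHom.comp (forgetMid A M 𝔡.counit).toAddHom)
    (g := (BaseExt.counit 𝔡.counit).toAddHom) (hom_ext fun _ _ _ => rfl) (σ a)

end Cosplit

/-! ### Frobenius systems -/

/-- A Frobenius system of an `A`-coring `C`: an `A`-central element `z` of `C` and a bimodule map
`π : C ⊗_A C → A` with `∑ c₁ π(c₂ ⊗ c') = ∑ π(c ⊗ c'₁) c'₂` and
`π(c ⊗ z) = ε(c) = π(z ⊗ c)`. -/
structure Coring.FrobeniusSystem {A : Type*} {C : Type*} [Ring A] [AddCommGroup C] [Module A C]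
    [Module Aᵐᵒᵖ C] [SMulCommClass A Aᵐᵒᵖ C] (𝔠 : Coring A C) where
  /-- the central element -/
  elt : C
  /-- the pairing -/
  pairing : BimodHom A A (NTensor A C C) A
  elt_central : ∀ a : A, a • elt = op a • elt
  comul_pairing : ∀ t,
    NTensor.rid A C (NTensor.map LinearMap.id pairing.left
      (NTensor.assoc A A C C C (NTensor.map 𝔠.comul.right LinearMap.id t))) =
    NTensor.lid A C (NTensor.map pairing.right LinearMap.id
      ((NTensor.assoc A A C C C).symm (NTensor.map LinearMap.id 𝔠.comul.left t)))
  pairing_elt : ∀ c, pairing (NTensor.tmul A c elt) = 𝔠.counit c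
  elt_pairing : ∀ c, pairing (NTensor.tmul A elt c) = 𝔠.counit c

section FrobeniusBimodule

variable {B : Type*} {A : Type*} {D : Type*} {M : Type*} [Ring B] [Ring A]
    [AddCommGroup D] [Module B D] [Module Bᵐᵒᵖ D] [SMulCommClass B Bᵐᵒᵖ D]
    [AddCommGroup M] [Module B M] [Module Aᵐᵒᵖ M] [SMulCommClass B Aᵐᵒᵖ M]

theorem LDual.sum_apply {ι : Type*} (s : Finset ι) (g : ι → LDual B M) (m : M) :
    (∑ i ∈ s, g i) m = ∑ i ∈ s, g i m :=
  LinearMap.sum_apply _ _ _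

/-- A finitely generated projective left module has a finite dual basis. -/
theorem LDual.exists_dualBasis (B M : Type*) [Ring B] [AddCommGroup M] [Module B M]
    [Module.Finite B M] [Module.Projective B M] :
    ∃ (n : ℕ) (t : Fin n → M) (h : Fin n → LDual B M), ∀ m, ∑ i, h i m • t i = m := by
  obtain ⟨n, p, hp⟩ := Module.Finite.exists_fin' B M
  obtain ⟨s, hs⟩ := Module.projective_lifting_property p LinearMap.id hp
  refine ⟨n, fun i => p (Pi.single i 1), fun i => (LinearMap.proj i).comp s, fun m => ?_⟩
  have h1 : p (s m) = m := LinearMap.congr_fun hs m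
  conv_rhs => rw [← h1, pi_eq_sum_univ' (s m)]
  rw [map_sum]
  refine Finset.sum_congr rfl fun i _ => ?_
  rw [map_smul]
  congr 2

/-- An isomorphism `γ : M^* ≃ ^*M` turns a dual basis of `_B M` into finite families `t_j` in `M`
and `k_j` in `M^*` that are dual to each other for the form `(m, f) ↦ γ(f)(m)`. -/
theorem IsFrobeniusBimodule.exists_dual_families (hM : IsFrobeniusBimodule B A M) :
    ∃ (γ : BimodHom A B (RDual A M) (LDual B M)) (n : ℕ) (t : Fin n → M)
      (k : Fin n → RDual A M), (∀ m, ∑ j, γ (k j) m • t j = m) ∧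
        ∀ f, ∑ j, op (γ f (t j)) • k j = f := by
  obtain ⟨γ, hγ⟩ := hM.exists_iso
  have := hM.finite_left
  have := hM.projective_left
  obtain ⟨n, t, h, ht⟩ := LDual.exists_dualBasis B M
  choose k hk using fun j => hγ.2 (h j)
  refine ⟨γ, n, t, k, fun m => by simp only [hk, ht], fun f => hγ.1 (LDual.ext fun m => ?_)⟩
  rw [map_sum, LDual.sum_apply]
  conv_rhs => rw [← ht m, map_sum]
  refine Finset.sum_congr rfl fun j _ => ?_
  rw [γ.map_right, hk, LDual.op_smul_apply, map_smul, smul_eq_mul]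

/-- The bimodule map `M ⊗_A M^* → B`, `m ⊗ f ↦ γ(f)(m)`. -/
def BimodHom.form (γ : BimodHom A B (RDual A M) (LDual B M)) :
    BimodHom B B (NTensor A M (RDual A M)) B :=
  (evalBimod B A M).comp
    { toAddHom := NTensor.map LinearMap.id γ.left
      map_left := fun b t => DFunLike.congr_fun
        (f := (NTensor.map LinearMap.id γ.left).comp (DistribSMul.toAddMonoidHom _ b))
        (g := (DistribSMul.toAddMonoidHom _ b).comp (NTensor.map LinearMap.id γ.left))
        (NTensor.hom_ext fun _ _ => rfl) t
      map_right := fun b t => DFunLike.congr_fun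
        (f := (NTensor.map LinearMap.id γ.left).comp (DistribSMul.toAddMonoidHom _ (op b)))
        (g := (DistribSMul.toAddMonoidHom _ (op b)).comp (NTensor.map LinearMap.id γ.left))
        (NTensor.hom_ext fun m f =>
          congrArg (fun g => NTensor.tmul A m g) (γ.map_right b f)) t }

theorem BimodHom.form_tmul (γ : BimodHom A B (RDual A M) (LDual B M)) (m : M) (f : RDual A M) :
    γ.form (NTensor.tmul A m f) = γ f m := rfl

namespace BaseExt

theorem sum_tri_right {ι : Type*} (s : Finset ι) (f : RDual A M) (d : D) (m : ι → M) :
    ∑ i ∈ s, tri (B := B) f d (m i) = tri f d (∑ i ∈ s, m i) :=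
  (map_sum (AddMonoidHom.mk' (fun x : M => tri (B := B) f d x) (tri_add_right f d)) _ _).symm

theorem sum_tri_left {ι : Type*} (s : Finset ι) (f : ι → RDual A M) (d : D) (m : M) :
    ∑ i ∈ s, tri (B := B) (f i) d m = tri (∑ i ∈ s, f i) d m :=
  (map_sum (AddMonoidHom.mk' (fun x : RDual A M => tri (B := B) x d m)
    fun x y => tri_add_left x y d m) _ _).symm

/-- The pairing `(f ⊗ d ⊗ m) ⊗ (f' ⊗ d' ⊗ m') ↦ f(π(d ω(m ⊗ f') ⊗ d') m')` on `M[D]`. -/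
def pairing (ω : BimodHom B B (NTensor A M (RDual A M)) B)
    (π : BimodHom B B (NTensor B D D) B) :
    BimodHom A A (NTensor A (BaseExt B A D M) (BaseExt B A D M)) A :=
  (counit π).comp (contract ω)

theorem pairing_tri (ω : BimodHom B B (NTensor A M (RDual A M)) B)
    (π : BimodHom B B (NTensor B D D) B) (f : RDual A M) (d : D) (m : M) (f' : RDual A M)
    (d' : D) (m' : M) :
    pairing ω π (NTensor.tmul A (tri f d m) (tri f' d' m')) =
      f (π (NTensor.tmul B (op (ω (NTensor.tmul A m f')) • d) d') • m') := rfl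

/-- Contraction and dual basis cancel: `∑ c₁ π(c₂ ⊗ c')` is computed in the middle factor, since
`∑ e_i e_i^*(x) = x`. -/
theorem comul_pairing_left (E : DualBasis A M) (ω : BimodHom B B (NTensor A M (RDual A M)) B)
    (π : BimodHom B B (NTensor B D D) B) (f : RDual A M) (m : M) (f' : RDual A M) (d' : D)
    (m' : M) (s : NTensor B D D) :
    NTensor.rid A _ (NTensor.map LinearMap.id (pairing ω π).left
      (NTensor.assoc A A _ _ _ (NTensor.tmul A (insertBasis E f m s) (tri f' d' m')))) =
    tri f (NTensor.rid B D (NTensor.map LinearMap.id π.left (NTensor.assoc B B D D D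
      (NTensor.tmul B (op (ω (NTensor.tmul A m f')) • s) d')))) m' := by
  induction s using NTensor.induction with
  | zero => simp only [map_zero, NTensor.zero_tmul, smul_zero, tri_zero_mid]
  | tmul x y =>
    rw [insertBasis_tmul, NTensor.sum_tmul, map_sum, map_sum, map_sum]
    refine Eq.trans (sum_tri_right Finset.univ f x fun i => op (E.f i
      (π (NTensor.tmul B (op (ω (NTensor.tmul A m f')) • y) d') • m')) • E.e i) ?_
    rw [E.sum_eq, ← tri_op_smul_mid]
    rfl
  | add x y hx hy => simp only [map_add, NTensor.add_tmul, smul_add, tri_add_mid, hx, hy]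

/-- The mirror image of `comul_pairing_left`, where the dual basis cancels because
`∑ f(e_i) e_i^* = f`. -/
theorem comul_pairing_right (E : DualBasis A M) (ω : BimodHom B B (NTensor A M (RDual A M)) B)
    (π : BimodHom B B (NTensor B D D) B) (f : RDual A M) (d : D) (m : M) (f' : RDual A M)
    (m' : M) (s : NTensor B D D) :
    NTensor.lid A _ (NTensor.map (pairing ω π).right LinearMap.id
      ((NTensor.assoc A A _ _ _).symm (NTensor.tmul A (tri f d m) (insertBasis E f' m' s)))) =
    tri f (NTensor.lid B D (NTensor.map π.right LinearMap.id ((NTensor.assoc B B D D D).symm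
      (NTensor.tmul B (op (ω (NTensor.tmul A m f')) • d) s)))) m' := by
  induction s using NTensor.induction with
  | zero => simp only [map_zero, NTensor.tmul_zero, tri_zero_mid]
  | tmul x y =>
    rw [insertBasis_tmul, NTensor.tmul_sum, map_sum, map_sum, map_sum]
    refine Eq.trans (sum_tri_left Finset.univ (fun i =>
      (op (π (NTensor.tmul B (op (ω (NTensor.tmul A m f')) • d) x)) • f) (E.e i) • E.f i) y m') ?_
    rw [E.sum_smul_eq, tri_op_smul_left]
    rfl
  | add x y hx hy => simp only [map_add, NTensor.tmul_add, tri_add_mid, hx, hy]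

end BaseExt

open BaseExt in
/-- A Frobenius bimodule transports a Frobenius system: the central element `z` of `D` becomes
`∑ k_j ⊗ z ⊗ t_j`, where `∑ k_j ⊗ t_j` is the `A`-central element of `M^* ⊗_B M` that
corresponds to the identity of `_B M` under `M^* ≃ ^*M`. -/
theorem Coring.FrobeniusSystem.nonempty_baseExtensionOf {𝔡 : Coring B D}
    (S : 𝔡.FrobeniusSystem) (E : DualBasis A M) (hM : IsFrobeniusBimodule B A M) :
    Nonempty (𝔡.baseExtensionOf E).FrobeniusSystem := by
  obtain ⟨γ, n, t, k, ht, hk⟩ := hM.exists_dual_families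
  refine ⟨⟨∑ j, tri (k j) S.elt (t j), BaseExt.pairing γ.form S.pairing, fun a => ?_, fun x => ?_,
    fun x => ?_, fun x => ?_⟩⟩
  · rw [Finset.smul_sum, Finset.smul_sum]
    simp only [smul_tri, op_smul_tri]
    -- expand `a k_j` in the family `k_i`, then collect `t_i a` in the family `t_j`
    calc ∑ j, tri (B := B) (a • k j) S.elt (t j)
        = ∑ j, ∑ i, tri (k i) S.elt (γ (k j) (op a • t i) • t j) := by
          refine Finset.sum_congr rfl fun j _ => ?_
          conv_lhs => rw [← hk (a • k j), ← sum_tri_left]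
          refine Finset.sum_congr rfl fun i _ => ?_
          rw [tri_op_smul_left, S.elt_central, tri_op_smul_mid, γ.map_left, LDual.smul_apply]
      _ = ∑ i, tri (k i) S.elt (op a • t i) := by
          rw [Finset.sum_comm]
          refine Finset.sum_congr rfl fun i _ => ?_
          rw [sum_tri_right, ht]
  · refine DFunLike.congr_fun
      (f := (NTensor.rid A _).comp ((NTensor.map LinearMap.id
          (BaseExt.pairing γ.form S.pairing).left).comp
        ((NTensor.assoc A A _ _ _).toAddMonoidHom.comp
          (NTensor.map (BaseExt.comul E 𝔡.comul).right LinearMap.id))))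
      (g := (NTensor.lid A _).comp ((NTensor.map
          (BaseExt.pairing γ.form S.pairing).right LinearMap.id).comp
        ((NTensor.assoc A A _ _ _).symm.toAddMonoidHom.comp
          (NTensor.map LinearMap.id (BaseExt.comul E 𝔡.comul).left))))
      (hom_ext₂ fun f d m f' d' m' => ?_) x
    refine (comul_pairing_left E _ _ f m f' d' m' (𝔡.comul d)).trans (Eq.trans ?_
      (comul_pairing_right E _ _ f d m f' m' (𝔡.comul d')).symm)
    rw [← 𝔡.comul.map_right]
    exact congrArg (fun y => tri f y m') (S.comul_pairing (NTensor.tmul B _ d'))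
  · refine DFunLike.congr_fun
      (f := (BaseExt.pairing γ.form S.pairing).toAddHom.comp
        (AddMonoidHom.mk' (fun x => NTensor.tmul A x (∑ j, tri (k j) S.elt (t j)))
          fun x y => NTensor.add_tmul x y _))
      (g := (BaseExt.counit 𝔡.counit).toAddHom) (hom_ext fun f d m => ?_) x
    change BaseExt.pairing γ.form S.pairing
      (NTensor.tmul A (tri f d m) (∑ j, tri (k j) S.elt (t j))) = f (𝔡.counit d • m)
    rw [NTensor.tmul_sum, map_sum]
    simp only [pairing_tri, S.pairing_elt, 𝔡.counit.map_right, op_smul_eq_mul, mul_smul,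
      BimodHom.form_tmul]
    rw [← map_sum, ← Finset.smul_sum, ht]
  · refine DFunLike.congr_fun
      (f := (BaseExt.pairing γ.form S.pairing).toAddHom.comp
        (AddMonoidHom.mk' (fun x => NTensor.tmul A (∑ j, tri (k j) S.elt (t j)) x)
          fun x y => NTensor.tmul_add _ x y))
      (g := (BaseExt.counit 𝔡.counit).toAddHom) (hom_ext fun f d m => ?_) x
    change BaseExt.pairing γ.form S.pairing
      (NTensor.tmul A (∑ j, tri (k j) S.elt (t j)) (tri f d m)) = f (𝔡.counit d • m)
    rw [NTensor.sum_tmul, map_sum]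
    simp only [pairing_tri, ← S.elt_central, ← NTensor.left_smul_tmul, S.pairing.map_left,
      S.elt_pairing, smul_eq_mul, mul_smul, BimodHom.form_tmul]
    simp only [← RDual.op_smul_apply (γ f _)]
    rw [← RDual.sum_apply, hk]

end FrobeniusBimodule

/-! ### Cofree comodules -/

namespace Coring

open CategoryTheory

variable {A : Type u} {C : Type u} [Ring A] [AddCommGroup C] [Module A C] [Module Aᵐᵒᵖ C]
    [SMulCommClass A Aᵐᵒᵖ C] (𝔠 : Coring A C)

/-- The coaction `n ⊗ c ↦ (n ⊗ c₁) ⊗ c₂` on `N ⊗_A C`. -/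
def cofreeCoact (N : Type u) [AddCommGroup N] [Module Aᵐᵒᵖ N] :
    NTensor A N C →ₗ[Aᵐᵒᵖ] NTensor A (NTensor A N C) C where
  toFun t := (NTensor.assoc A A N C C).symm (NTensor.map LinearMap.id 𝔠.comul.left t)
  map_add' x y := by rw [map_add, map_add]
  map_smul' a t := DFunLike.congr_fun
    (f := ((NTensor.assoc A A N C C).symm.toAddMonoidHom.comp
      (NTensor.map LinearMap.id 𝔠.comul.left)).comp (DistribSMul.toAddMonoidHom _ a))
    (g := (DistribSMul.toAddMonoidHom _ a).comp ((NTensor.assoc A A N C C).symm.toAddMonoidHom.comp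
      (NTensor.map LinearMap.id 𝔠.comul.left)))
    (NTensor.hom_ext fun n c => by
      change (NTensor.assoc A A N C C).symm (NTensor.tmul A n (𝔠.comul (op a.unop • c))) =
        a • (NTensor.assoc A A N C C).symm (NTensor.tmul A n (𝔠.comul c))
      rw [𝔠.comul.map_right, op_unop]
      generalize 𝔠.comul c = s
      induction s using NTensor.induction with
      | zero => simp only [smul_zero, NTensor.tmul_zero, map_zero]
      | tmul x y => rfl
      | add x y hx hy => simp only [smul_add, NTensor.tmul_add, map_add, hx, hy]) t

/-- The cofree right comodule `N ⊗_A C`. -/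
def cofreeObj (N : ModuleCat.{u} Aᵐᵒᵖ) : RComod 𝔠 where
  X := ModuleCat.of Aᵐᵒᵖ (NTensor A N C)
  coact := 𝔠.cofreeCoact N
  coassoc t := by
    refine DFunLike.congr_fun
      (f := (NTensor.assoc A A (NTensor A N C) C C).toAddMonoidHom.comp
        ((NTensor.map (𝔠.cofreeCoact N) LinearMap.id).comp (𝔠.cofreeCoact N).toAddMonoidHom))
      (g := (NTensor.map LinearMap.id 𝔠.comul.left).comp (𝔠.cofreeCoact N).toAddMonoidHom)
      (NTensor.hom_ext fun n c => ?_) t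
    have h0 : ∀ (u : NTensor A C C) (y : C),
        NTensor.assoc A A (NTensor A N C) C C
          (NTensor.tmul A ((NTensor.assoc A A N C C).symm (NTensor.tmul A n u)) y) =
        (NTensor.assoc A A N C (NTensor A C C)).symm
          (NTensor.tmul A n (NTensor.assoc A A C C C (NTensor.tmul A u y))) := fun u y => by
      induction u using NTensor.induction with
      | zero => simp only [NTensor.tmul_zero, NTensor.zero_tmul, map_zero]
      | tmul x z => rfl
      | add x z hx hz => simp only [NTensor.tmul_add, NTensor.add_tmul, map_add, hx, hz]
    have h1 : ∀ s : NTensor A C C,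
        NTensor.assoc A A (NTensor A N C) C C (NTensor.map (𝔠.cofreeCoact N) LinearMap.id
          ((NTensor.assoc A A N C C).symm (NTensor.tmul A n s))) =
        (NTensor.assoc A A N C (NTensor A C C)).symm (NTensor.tmul A n
          (NTensor.assoc A A C C C (NTensor.map 𝔠.comul.right LinearMap.id s))) := fun s => by
      induction s using NTensor.induction with
      | zero => simp only [NTensor.tmul_zero, map_zero]
      | tmul x y => exact h0 (𝔠.comul x) y
      | add x y hx hy => simp only [NTensor.tmul_add, map_add, hx, hy]
    have h2 : ∀ s : NTensor A C C,
        NTensor.map LinearMap.id 𝔠.comul.left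
          ((NTensor.assoc A A N C C).symm (NTensor.tmul A n s)) =
        (NTensor.assoc A A N C (NTensor A C C)).symm (NTensor.tmul A n
          (NTensor.map LinearMap.id 𝔠.comul.left s)) := fun s => by
      induction s using NTensor.induction with
      | zero => simp only [NTensor.tmul_zero, map_zero]
      | tmul x y => rfl
      | add x y hx hy => simp only [NTensor.tmul_add, map_add, hx, hy]
    refine (h1 (𝔠.comul c)).trans (Eq.trans ?_ (h2 (𝔠.comul c)).symm)
    rw [𝔠.coassoc]
  counit t := by
    refine DFunLike.congr_fun
      (f := (NTensor.rid A (NTensor A N C)).comp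
        ((NTensor.map LinearMap.id 𝔠.counit.left).comp (𝔠.cofreeCoact N).toAddMonoidHom))
      (g := AddMonoidHom.id _) (NTensor.hom_ext fun n c => ?_) t
    have h : ∀ s : NTensor A C C,
        NTensor.rid A (NTensor A N C) (NTensor.map LinearMap.id 𝔠.counit.left
          ((NTensor.assoc A A N C C).symm (NTensor.tmul A n s))) =
        NTensor.tmul A n (NTensor.rid A C (NTensor.map LinearMap.id 𝔠.counit.left s)) :=
      fun s => by
        induction s using NTensor.induction with
        | zero => simp only [NTensor.tmul_zero, map_zero]
        | tmul x y => rfl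
        | add x y hx hy => simp only [NTensor.tmul_add, map_add, hx, hy]
    refine (h (𝔠.comul c)).trans ?_
    rw [𝔠.counit_right]
    rfl

variable (C) in
/-- The right linear map `f ⊗_A C`. -/
def rmap {N N' : Type u} [AddCommGroup N] [AddCommGroup N'] [Module Aᵐᵒᵖ N] [Module Aᵐᵒᵖ N']
    (f : N →ₗ[Aᵐᵒᵖ] N') : NTensor A N C →ₗ[Aᵐᵒᵖ] NTensor A N' C where
  toFun t := NTensor.map f LinearMap.id t
  map_add' := map_add _
  map_smul' a t := DFunLike.congr_fun
    (f := (NTensor.map f (LinearMap.id : C →ₗ[A] C)).comp (DistribSMul.toAddMonoidHom _ a))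
    (g := (DistribSMul.toAddMonoidHom _ a).comp (NTensor.map f (LinearMap.id : C →ₗ[A] C)))
    (NTensor.hom_ext fun _ _ => rfl) t

/-- Assemble a morphism of comodules from a linear colinear map. -/
def RComod.mkHom {𝔠 : Coring A C} {X Y : RComod 𝔠} (f : X.X →ₗ[Aᵐᵒᵖ] Y.X)
    (h : ∀ x, Y.coact (f x) = NTensor.map f LinearMap.id (X.coact x)) : X ⟶ Y :=
  RComod.Hom.mk (ModuleCat.ofHom f) h

theorem RComod.hom_ext {𝔠 : Coring A C} {X Y : RComod 𝔠} {f g : X ⟶ Y}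
    (h : ∀ x, f.hom.hom x = g.hom.hom x) : f = g :=
  RComod.Hom.ext (ModuleCat.hom_ext (LinearMap.ext h))

theorem cofreeCoact_rmap {N N' : Type u} [AddCommGroup N] [AddCommGroup N'] [Module Aᵐᵒᵖ N]
    [Module Aᵐᵒᵖ N'] (f : N →ₗ[Aᵐᵒᵖ] N') (t : NTensor A N C) :
    𝔠.cofreeCoact N' (rmap C f t) =
      NTensor.map (rmap C f) LinearMap.id (𝔠.cofreeCoact N t) := by
  refine DFunLike.congr_fun
    (f := (𝔠.cofreeCoact N').toAddMonoidHom.comp (rmap C f).toAddMonoidHom)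
    (g := (NTensor.map (rmap C f) LinearMap.id).comp (𝔠.cofreeCoact N).toAddMonoidHom)
    (NTensor.hom_ext fun n c => ?_) t
  change (NTensor.assoc A A N' C C).symm (NTensor.tmul A (f n) (𝔠.comul c)) =
    NTensor.map (rmap C f) LinearMap.id
      ((NTensor.assoc A A N C C).symm (NTensor.tmul A n (𝔠.comul c)))
  generalize 𝔠.comul c = s
  induction s using NTensor.induction with
  | zero => simp only [NTensor.tmul_zero, map_zero]
  | tmul x y => rfl
  | add x y hx hy => simp only [NTensor.tmul_add, map_add, hx, hy]

/-- The cofree comodule functor `- ⊗_A C`. -/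
def cofree : ModuleCat.{u} Aᵐᵒᵖ ⥤ RComod 𝔠 where
  obj N := 𝔠.cofreeObj N
  map {N N'} f := RComod.mkHom (X := 𝔠.cofreeObj N) (Y := 𝔠.cofreeObj N') (rmap C f.hom)
    (𝔠.cofreeCoact_rmap f.hom)
  map_id N := RComod.hom_ext fun t => DFunLike.congr_fun
    (f := NTensor.map (LinearMap.id : N →ₗ[Aᵐᵒᵖ] N) (LinearMap.id : C →ₗ[A] C))
    (g := AddMonoidHom.id _) (NTensor.hom_ext fun _ _ => rfl) t
  map_comp f g := RComod.hom_ext fun t => DFunLike.congr_fun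
    (f := NTensor.map (f ≫ g).hom (LinearMap.id : C →ₗ[A] C))
    (g := (NTensor.map g.hom LinearMap.id).comp (NTensor.map f.hom LinearMap.id))
    (NTensor.hom_ext fun _ _ => rfl) t

/-- The linear map `n ⊗ c ↦ n ε(c)`. -/
def cofreeCounit (N : Type u) [AddCommGroup N] [Module Aᵐᵒᵖ N] :
    NTensor A N C →ₗ[Aᵐᵒᵖ] N where
  toFun t := NTensor.rid A N (NTensor.map LinearMap.id 𝔠.counit.left t)
  map_add' x y := by rw [map_add, map_add]
  map_smul' a t := DFunLike.congr_fun
    (f := ((NTensor.rid A N).comp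
      (NTensor.map LinearMap.id 𝔠.counit.left)).comp (DistribSMul.toAddMonoidHom _ a))
    (g := (DistribSMul.toAddMonoidHom _ a).comp ((NTensor.rid A N).comp
      (NTensor.map LinearMap.id 𝔠.counit.left)))
    (NTensor.hom_ext fun n c => by
      change op (𝔠.counit (op a.unop • c)) • n = a • op (𝔠.counit c) • n
      rw [𝔠.counit.map_right, op_smul_eq_mul, op_mul, mul_smul, op_unop]) t

/-- The forgetful functor is left adjoint to the cofree comodule functor: the unit is the coaction
and the counit is `n ⊗ c ↦ n ε(c)`. -/
def forgetCofreeAdjunction : 𝔠.forgetComod ⊣ 𝔠.cofree where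
  unit :=
    { app := fun X => RComod.mkHom (X := X) (Y := 𝔠.cofreeObj X.X) X.coact fun x => by
        change (NTensor.assoc A A X.X C C).symm
          (NTensor.map LinearMap.id 𝔠.comul.left (X.coact x)) = _
        rw [← X.coassoc, AddEquiv.symm_apply_apply]
        rfl
      naturality := fun X Y f => RComod.hom_ext fun x => f.colinear x }
  counit :=
    { app := fun N => ModuleCat.ofHom (𝔠.cofreeCounit N)
      naturality := fun N N' f => ModuleCat.hom_ext (LinearMap.ext fun t => by
        refine DFunLike.congr_fun
          (f := (𝔠.cofreeCounit N').toAddMonoidHom.comp (rmap C f.hom).toAddMonoidHom)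
          (g := f.hom.toAddMonoidHom.comp (𝔠.cofreeCounit N).toAddMonoidHom)
          (NTensor.hom_ext fun n c => ?_) t
        exact (f.hom.map_smul (op (𝔠.counit c)) n).symm) }
  left_triangle_components X := ModuleCat.hom_ext (LinearMap.ext fun x => X.counit x)
  right_triangle_components N := RComod.hom_ext fun t => by
    refine DFunLike.congr_fun
      (f := (rmap C (𝔠.cofreeCounit N)).toAddMonoidHom.comp (𝔠.cofreeCoact N).toAddMonoidHom)
      (g := AddMonoidHom.id _) (NTensor.hom_ext fun n c => ?_) t
    have h : ∀ s : NTensor A C C, NTensor.map (𝔠.cofreeCounit N) LinearMap.id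
        ((NTensor.assoc A A N C C).symm (NTensor.tmul A n s)) =
        NTensor.tmul A n (NTensor.lid A C (NTensor.map 𝔠.counit.right LinearMap.id s)) :=
      fun s => by
        induction s using NTensor.induction with
        | zero => simp only [NTensor.tmul_zero, map_zero]
        | tmul x y => exact NTensor.smul_tmul (𝔠.counit x) n y
        | add x y hx hy => simp only [NTensor.tmul_add, map_add, hx, hy]
    refine (h (𝔠.comul c)).trans ?_
    rw [𝔠.counit_left]
    rfl

/-! ### From Frobenius systems to Frobenius functors -/

namespace FrobeniusSystem

variable {𝔠} (S : 𝔠.FrobeniusSystem)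

/-- The linear map `n ↦ n ⊗ z`. -/
def unitMap (N : Type u) [AddCommGroup N] [Module Aᵐᵒᵖ N] : N →ₗ[Aᵐᵒᵖ] NTensor A N C where
  toFun n := NTensor.tmul A n S.elt
  map_add' n n' := NTensor.add_tmul _ _ _
  map_smul' a n := by
    rw [RingHom.id_apply, ← op_unop a, NTensor.smul_tmul, S.elt_central, NTensor.right_smul_tmul]

/-- The linear map `(n ⊗ c) ⊗ c' ↦ n π(c ⊗ c')`. -/
def contractPair (N : Type u) [AddCommGroup N] [Module Aᵐᵒᵖ N] :
    NTensor A (NTensor A N C) C →ₗ[Aᵐᵒᵖ] N where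
  toFun t := NTensor.rid A N (NTensor.map LinearMap.id S.pairing.left (NTensor.assoc A A N C C t))
  map_add' x y := by rw [map_add, map_add, map_add]
  map_smul' a t := DFunLike.congr_fun
    (f := ((NTensor.rid A N).comp ((NTensor.map LinearMap.id S.pairing.left).comp
      (NTensor.assoc A A N C C).toAddMonoidHom)).comp (DistribSMul.toAddMonoidHom _ a))
    (g := (DistribSMul.toAddMonoidHom _ a).comp ((NTensor.rid A N).comp
      ((NTensor.map LinearMap.id S.pairing.left).comp (NTensor.assoc A A N C C).toAddMonoidHom)))
    (NTensor.hom_ext fun s c => by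
      induction s using NTensor.induction with
      | zero => simp only [NTensor.zero_tmul, map_zero]
      | tmul n d =>
        change op (S.pairing (op a.unop • NTensor.tmul A d c)) • n =
          a • op (S.pairing (NTensor.tmul A d c)) • n
        rw [S.pairing.map_right, op_smul_eq_mul, op_mul, mul_smul, op_unop]
      | add x y hx hy => rw [NTensor.add_tmul, map_add, map_add, hx, hy]) t

theorem contractPair_tmul (N : Type u) [AddCommGroup N] [Module Aᵐᵒᵖ N] (n : N) (c c' : C) :
    S.contractPair N (NTensor.tmul A (NTensor.tmul A n c) c') =
      op (S.pairing (NTensor.tmul A c c')) • n := rfl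

/-- The linear map `x ⊗ c ↦ ∑ x₀ π(x₁ ⊗ c)`. -/
def counitMap (X : RComod 𝔠) : NTensor A X.X C →ₗ[Aᵐᵒᵖ] X.X :=
  (S.contractPair X.X).comp (rmap C X.coact)

/-- The compatibility of `π` with the comultiplication, tensored with `N`. -/
theorem contractPair_cofreeCoact (N : Type u) [AddCommGroup N] [Module Aᵐᵒᵖ N] (n : N) (d c : C) :
    S.contractPair (NTensor A N C) (NTensor.tmul A (𝔠.cofreeCoact N (NTensor.tmul A n d)) c) =
      NTensor.tmul A n (NTensor.lid A C (NTensor.map S.pairing.right LinearMap.id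
        ((NTensor.assoc A A C C C).symm (NTensor.tmul A d (𝔠.comul c))))) := by
  have h : ∀ s : NTensor A C C, S.contractPair (NTensor A N C)
      (NTensor.tmul A ((NTensor.assoc A A N C C).symm (NTensor.tmul A n s)) c) =
      NTensor.tmul A n (NTensor.rid A C (NTensor.map LinearMap.id S.pairing.left
        (NTensor.assoc A A C C C (NTensor.tmul A s c)))) := fun s => by
    induction s using NTensor.induction with
    | zero => simp only [NTensor.tmul_zero, NTensor.zero_tmul, map_zero]
    | tmul x y => rfl
    | add x y hx hy => simp only [NTensor.tmul_add, NTensor.add_tmul, map_add, hx, hy]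
  refine (h (𝔠.comul d)).trans ?_
  exact congrArg (fun y => NTensor.tmul A n y) (S.comul_pairing (NTensor.tmul A d c))

/-- The counit of the adjunction takes values in comodule maps. This is where both sides of
`∑ c₁ π(c₂ ⊗ c') = ∑ π(c ⊗ c'₁) c'₂` are used. -/
theorem counitMap_colinear (X : RComod 𝔠) (t : NTensor A X.X C) :
    X.coact (S.counitMap X t) =
      NTensor.map (S.counitMap X) LinearMap.id (𝔠.cofreeCoact X.X t) := by
  refine DFunLike.congr_fun
    (f := X.coact.toAddMonoidHom.comp (S.counitMap X).toAddMonoidHom)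
    (g := (NTensor.map (S.counitMap X) LinearMap.id).comp (𝔠.cofreeCoact X.X).toAddMonoidHom)
    (NTensor.hom_ext fun x c => ?_) t
  -- both sides are `∑ x₀ ⊗ x₁ π(x₂ ⊗ c) = ∑ x₀ ⊗ π(x₁ ⊗ c₁) c₂`
  have h1 : ∀ s : NTensor A X.X C, X.coact (S.contractPair X.X (NTensor.tmul A s c)) =
      S.contractPair (NTensor A X.X C)
        (NTensor.tmul A (NTensor.map X.coact LinearMap.id s) c) := fun s => by
    induction s using NTensor.induction with
    | zero => simp only [NTensor.zero_tmul, map_zero]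
    | tmul y d =>
      rw [contractPair_tmul, map_smul]
      rfl
    | add x y hx hy => simp only [NTensor.add_tmul, map_add, hx, hy]
  have h2 : ∀ s : NTensor A X.X C,
      S.contractPair (NTensor A X.X C) (NTensor.tmul A (𝔠.cofreeCoact X.X s) c) =
      NTensor.map (S.contractPair X.X) LinearMap.id
        ((NTensor.assoc A A (NTensor A X.X C) C C).symm (NTensor.tmul A s (𝔠.comul c))) :=
    fun s => by
      induction s using NTensor.induction with
      | zero => simp only [NTensor.zero_tmul, map_zero]
      | tmul y d =>
        rw [contractPair_cofreeCoact]
        generalize 𝔠.comul c = r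
        induction r using NTensor.induction with
        | zero => simp only [NTensor.tmul_zero, map_zero]
        | tmul u v => exact (NTensor.smul_tmul (S.pairing (NTensor.tmul A d u)) y v).symm
        | add x y hx hy => simp only [NTensor.tmul_add, map_add, hx, hy]
      | add x y hx hy => simp only [NTensor.add_tmul, map_add, hx, hy]
  have h3 : ∀ r : NTensor A C C,
      NTensor.map (S.contractPair X.X) LinearMap.id
        ((NTensor.assoc A A (NTensor A X.X C) C C).symm (NTensor.tmul A (X.coact x) r)) =
      NTensor.map (S.counitMap X) LinearMap.id
        ((NTensor.assoc A A X.X C C).symm (NTensor.tmul A x r)) := fun r => by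
    induction r using NTensor.induction with
    | zero => simp only [NTensor.tmul_zero, map_zero]
    | tmul u v => rfl
    | add x y hx hy => simp only [NTensor.tmul_add, map_add, hx, hy]
  have h4 : NTensor.map X.coact LinearMap.id (X.coact x) = 𝔠.cofreeCoact X.X (X.coact x) := by
    change _ = (NTensor.assoc A A X.X C C).symm
      (NTensor.map LinearMap.id 𝔠.comul.left (X.coact x))
    rw [← X.coassoc, AddEquiv.symm_apply_apply]
  refine (h1 (X.coact x)).trans ?_
  rw [h4, h2]
  exact h3 (𝔠.comul c)

/-- A Frobenius system makes the cofree comodule functor left adjoint to the forgetful functor: the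
unit is `n ↦ n ⊗ z` and the counit is `x ⊗ c ↦ ∑ x₀ π(x₁ ⊗ c)`. -/
def cofreeForgetAdjunction : 𝔠.cofree ⊣ 𝔠.forgetComod where
  unit :=
    { app := fun N => ModuleCat.ofHom (S.unitMap N)
      naturality := fun _ _ _ => rfl }
  counit :=
    { app := fun X => RComod.mkHom (X := 𝔠.cofreeObj X.X) (Y := X) (S.counitMap X)
        (S.counitMap_colinear X)
      naturality := fun X Y f => RComod.hom_ext fun t => by
        refine DFunLike.congr_fun
          (f := (S.counitMap Y).toAddMonoidHom.comp (rmap C f.hom.hom).toAddMonoidHom)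
          (g := f.hom.hom.toAddMonoidHom.comp (S.counitMap X).toAddMonoidHom)
          (NTensor.hom_ext fun x c => ?_) t
        change S.contractPair Y.X (NTensor.tmul A (Y.coact (f.hom.hom x)) c) =
          f.hom.hom (S.contractPair X.X (NTensor.tmul A (X.coact x) c))
        rw [f.colinear]
        generalize X.coact x = s
        induction s using NTensor.induction with
        | zero => simp only [NTensor.zero_tmul, map_zero]
        | tmul y d => exact (f.hom.hom.map_smul (op (S.pairing (NTensor.tmul A d c))) y).symm
        | add x y hx hy => simp only [NTensor.add_tmul, map_add, hx, hy] }
  left_triangle_components N := RComod.hom_ext fun t => by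
    refine DFunLike.congr_fun
      (f := (S.counitMap (𝔠.cofreeObj N)).toAddMonoidHom.comp
        (rmap C (S.unitMap N)).toAddMonoidHom)
      (g := AddMonoidHom.id _) (NTensor.hom_ext fun n c => ?_) t
    refine (S.contractPair_cofreeCoact N n S.elt c).trans ?_
    have h : ∀ s : NTensor A C C, NTensor.map S.pairing.right LinearMap.id
        ((NTensor.assoc A A C C C).symm (NTensor.tmul A S.elt s)) =
        NTensor.map 𝔠.counit.right LinearMap.id s := fun s => by
      induction s using NTensor.induction with
      | zero => simp only [NTensor.tmul_zero, map_zero]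
      | tmul x y => exact congrArg (fun a => NTensor.tmul A a y) (S.elt_pairing x)
      | add x y hx hy => simp only [NTensor.tmul_add, map_add, hx, hy]
    rw [h, 𝔠.counit_left]
    rfl
  right_triangle_components X := ModuleCat.hom_ext (LinearMap.ext fun x => by
    change S.contractPair X.X (NTensor.tmul A (X.coact x) S.elt) = x
    conv_rhs => rw [← X.counit x]
    generalize X.coact x = s
    induction s using NTensor.induction with
    | zero => simp only [NTensor.zero_tmul, map_zero]
    | tmul y d => exact congrArg (fun a => op a • y) (S.pairing_elt d)
    | add x y hx hy => simp only [NTensor.add_tmul, map_add, hx, hy])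

theorem isFrobenius (S : 𝔠.FrobeniusSystem) : 𝔠.IsFrobenius :=
  ⟨𝔠.cofree, ⟨𝔠.forgetCofreeAdjunction⟩, ⟨S.cofreeForgetAdjunction⟩⟩

end FrobeniusSystem

/-! ### From Frobenius functors to Frobenius systems -/

section OfAdjunction

variable {𝔠} (adj : 𝔠.cofree ⊣ 𝔠.forgetComod)

/-- The component at `N` of the unit of an adjunction between `- ⊗_A C` and the forgetful
functor. -/
def adjUnit (N : Type u) [AddCommGroup N] [Module Aᵐᵒᵖ N] : N →ₗ[Aᵐᵒᵖ] NTensor A N C :=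
  (adj.unit.app (ModuleCat.of Aᵐᵒᵖ N)).hom

/-- The component at `X` of the counit of an adjunction between `- ⊗_A C` and the forgetful
functor. -/
def adjCounit (X : RComod 𝔠) : NTensor A X.X C →ₗ[Aᵐᵒᵖ] X.X :=
  (adj.counit.app X).hom.hom

theorem adjUnit_naturality {N N' : Type u} [AddCommGroup N] [AddCommGroup N'] [Module Aᵐᵒᵖ N]
    [Module Aᵐᵒᵖ N'] (f : N →ₗ[Aᵐᵒᵖ] N') (n : N) :
    adjUnit adj N' (f n) = rmap C f (adjUnit adj N n) :=
  LinearMap.congr_fun (congrArg ModuleCat.Hom.hom (adj.unit.naturality (ModuleCat.ofHom f))) n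

theorem adjCounit_naturality {X Y : RComod 𝔠} (f : X ⟶ Y) (t : NTensor A X.X C) :
    adjCounit adj Y (rmap C f.hom.hom t) = f.hom.hom (adjCounit adj X t) :=
  LinearMap.congr_fun (congrArg (fun g => (RComod.Hom.hom g).hom) (adj.counit.naturality f)) t

/-- The counit of the adjunction is a comodule map. -/
theorem coact_adjCounit (X : RComod 𝔠) (t : NTensor A X.X C) :
    X.coact (adjCounit adj X t) =
      NTensor.map (adjCounit adj X) LinearMap.id (𝔠.cofreeCoact X.X t) :=
  (adj.counit.app X).colinear t

theorem adjCounit_adjUnit (X : RComod 𝔠) (x : X.X) : adjCounit adj X (adjUnit adj X.X x) = x :=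
  LinearMap.congr_fun (congrArg ModuleCat.Hom.hom (adj.right_triangle_components X)) x

/-- The component at `N ⊗_A C` of the counit of an adjunction between `- ⊗_A C` and the forgetful
functor. -/
def adjCounitCofree (N : Type u) [AddCommGroup N] [Module Aᵐᵒᵖ N] :
    NTensor A (NTensor A N C) C →ₗ[Aᵐᵒᵖ] NTensor A N C :=
  adjCounit adj (𝔠.cofreeObj (ModuleCat.of Aᵐᵒᵖ N))

theorem adjCounitCofree_rmap_adjUnit (N : Type u) [AddCommGroup N] [Module Aᵐᵒᵖ N]
    (t : NTensor A N C) :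
    adjCounitCofree adj N (rmap C (adjUnit adj N) t) = t :=
  LinearMap.congr_fun (congrArg (fun g => (RComod.Hom.hom g).hom)
    (adj.left_triangle_components (ModuleCat.of Aᵐᵒᵖ N))) t

variable (𝔠) in
/-- The coring as a right comodule over itself. -/
def regular : RComod 𝔠 where
  X := ModuleCat.of Aᵐᵒᵖ C
  coact := 𝔠.comul.right
  coassoc := 𝔠.coassoc
  counit := 𝔠.counit_right

/-- The component at `C` of the counit of an adjunction between `- ⊗_A C` and the forgetful
functor. -/
def adjCounitRegular : NTensor A C C →ₗ[Aᵐᵒᵖ] C :=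
  adjCounit adj 𝔠.regular

/-- The central element that corresponds to the unit of the adjunction. -/
def adjElt : C := NTensor.lid A C (adjUnit adj A 1)

/-- By naturality along `A → N`, `1 ↦ n`, the unit is `n ↦ n ⊗ z`. -/
theorem adjUnit_eq (N : Type u) [AddCommGroup N] [Module Aᵐᵒᵖ N] (n : N) :
    adjUnit adj N n = NTensor.tmul A n (adjElt adj) := by
  have h := adjUnit_naturality adj (LinearMap.toSpanSingleton Aᵐᵒᵖ N n ∘ₗ
    ({ toFun := op, map_add' := fun _ _ => rfl, map_smul' := fun _ _ => rfl } : A →ₗ[Aᵐᵒᵖ] Aᵐᵒᵖ)) 1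
  have h1 : ∀ t : NTensor A A C, rmap C (LinearMap.toSpanSingleton Aᵐᵒᵖ N n ∘ₗ
      ({ toFun := op, map_add' := fun _ _ => rfl, map_smul' := fun _ _ => rfl } :
        A →ₗ[Aᵐᵒᵖ] Aᵐᵒᵖ)) t = NTensor.tmul A n (NTensor.lid A C t) := fun t => by
    induction t using NTensor.induction with
    | zero => simp only [map_zero, NTensor.tmul_zero]
    | tmul a c => exact NTensor.smul_tmul a n c
    | add x y hx hy => rw [map_add, map_add, hx, hy, NTensor.tmul_add]
  rw [h1] at h
  refine Eq.trans (congrArg _ ?_) h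
  exact (one_smul Aᵐᵒᵖ n).symm

theorem adjElt_central (a : A) : a • adjElt adj = op a • adjElt adj := by
  -- compare `a ⊗ z = η(a) = η(1) a = (1 ⊗ z) a`
  have h := (adjUnit adj A).map_smul (op a) 1
  rw [op_smul_eq_mul, one_mul, adjUnit_eq, adjUnit_eq, NTensor.right_smul_tmul] at h
  have h' := congrArg (NTensor.lid A C) h
  rwa [NTensor.lid_tmul, NTensor.lid_tmul, one_smul] at h'

/-- The counit at `N ⊗_A C` is determined by the counit at `C`, by naturality along the comodule
maps `c ↦ n ⊗ c`. -/
theorem adjCounitCofree_tmul (N : Type u) [AddCommGroup N] [Module Aᵐᵒᵖ N] (n : N) (c c' : C) :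
    adjCounitCofree adj N (NTensor.tmul A (NTensor.tmul A n c) c') =
      NTensor.tmul A n (adjCounitRegular adj (NTensor.tmul A c c')) :=
  adjCounit_naturality adj (X := 𝔠.regular) (Y := 𝔠.cofreeObj (ModuleCat.of Aᵐᵒᵖ N))
    (RComod.mkHom (X := 𝔠.regular) (Y := 𝔠.cofreeObj (ModuleCat.of Aᵐᵒᵖ N))
      ({ toFun := fun c => NTensor.tmul A n c
         map_add' := NTensor.tmul_add n
         map_smul' := fun _ _ => rfl } : C →ₗ[Aᵐᵒᵖ] NTensor A N C)
      fun c => by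
        change (NTensor.assoc A A N C C).symm (NTensor.tmul A n (𝔠.comul c)) =
          NTensor.map _ LinearMap.id (𝔠.comul c)
        generalize 𝔠.comul c = s
        induction s using NTensor.induction with
        | zero => simp only [NTensor.tmul_zero, map_zero]
        | tmul x y => rfl
        | add x y hx hy => simp only [NTensor.tmul_add, map_add, hx, hy])
    (NTensor.tmul A c c')

/-- Left multiplication by `a` on `C` as a right linear map. -/
def leftMul (a : A) : C →ₗ[Aᵐᵒᵖ] C where
  toFun c := a • c
  map_add' := smul_add a
  map_smul' r c := smul_comm a r c

/-- The counit at `C` as a bimodule map `C ⊗_A C → C`. -/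
def adjCounitBimod : BimodHom A A (NTensor A C C) C where
  toAddHom := (adjCounitRegular adj).toAddMonoidHom
  map_left a t :=
    Eq.trans (congrArg (adjCounitRegular adj) (DFunLike.congr_fun
        (f := DistribSMul.toAddMonoidHom (NTensor A C C) a)
        (g := (rmap C (leftMul a)).toAddMonoidHom) (NTensor.hom_ext fun _ _ => rfl) t))
      (adjCounit_naturality adj (X := 𝔠.regular) (Y := 𝔠.regular)
        (RComod.mkHom (X := 𝔠.regular) (Y := 𝔠.regular) (show C →ₗ[Aᵐᵒᵖ] C from leftMul a) fun c =>
          (𝔠.comul.map_left a c).trans (DFunLike.congr_fun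
            (f := DistribSMul.toAddMonoidHom (NTensor A C C) a)
            (g := NTensor.map (leftMul a) LinearMap.id)
            (NTensor.hom_ext fun _ _ => rfl) (𝔠.comul c))) t)
  map_right a t := (adjCounitRegular adj).map_smul (op a) t

theorem adjCounitBimod_apply (t : NTensor A C C) :
    adjCounitBimod adj t = adjCounitRegular adj t := rfl

/-- The counit at `C` is left colinear: it is natural along the comodule map `Δ : C → C ⊗_A C`, and
the counit at the cofree comodule `C ⊗_A C` is `C ⊗_A ζ_C`, where `ζ_C` is the counit at `C`. -/
theorem comul_adjCounitBimod (t : NTensor A C C) :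
    𝔠.comul (adjCounitBimod adj t) = NTensor.map LinearMap.id (adjCounitBimod adj).left
      (NTensor.assoc A A C C C (NTensor.map 𝔠.comul.right LinearMap.id t)) := by
  have h := adjCounit_naturality adj (X := 𝔠.regular) (Y := 𝔠.cofreeObj (ModuleCat.of Aᵐᵒᵖ C))
    (𝔠.forgetCofreeAdjunction.unit.app 𝔠.regular) t
  refine Eq.trans h.symm ?_
  have h1 : ∀ s : NTensor A (NTensor A C C) C,
      adjCounitCofree adj C s =
      NTensor.map LinearMap.id (adjCounitBimod adj).left (NTensor.assoc A A C C C s) := fun s => by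
    refine DFunLike.congr_fun
      (f := (adjCounitCofree adj C).toAddMonoidHom)
      (g := (NTensor.map LinearMap.id (adjCounitBimod adj).left).comp
        (NTensor.assoc A A C C C).toAddMonoidHom) (NTensor.hom_ext fun r c' => ?_) s
    induction r using NTensor.induction with
    | zero => simp only [NTensor.zero_tmul, map_zero]
    | tmul n c => exact adjCounitCofree_tmul adj C n c c'
    | add x y hx hy => rw [NTensor.add_tmul, map_add, map_add, hx, hy]
  exact h1 _

/-- A coring whose cofree comodule functor is left adjoint to the forgetful functor has a Frobenius
system, with pairing `ε ∘ ζ_C` for the counit `ζ` of the adjunction. -/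
def frobeniusSystemOfAdjunction : 𝔠.FrobeniusSystem where
  elt := adjElt adj
  pairing := 𝔠.counit.comp (adjCounitBimod adj)
  elt_central := adjElt_central adj
  comul_pairing t := by
    -- both sides are `ζ_C(t)`, by left and right colinearity of `ζ_C` and the counit axioms
    have hl := 𝔠.counit_right (adjCounitBimod adj t)
    rw [comul_adjCounitBimod] at hl
    have hr := 𝔠.counit_left (adjCounitBimod adj t)
    have hc : 𝔠.comul (adjCounitBimod adj t) =
        NTensor.map (adjCounitBimod adj).right LinearMap.id ((NTensor.assoc A A C C C).symm
          (NTensor.map LinearMap.id 𝔠.comul.left t)) := coact_adjCounit adj 𝔠.regular t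
    rw [hc] at hr
    refine Eq.trans ?_ (hl.trans (hr.symm.trans ?_))
    · exact congrArg (NTensor.rid A C) (DFunLike.congr_fun
        (f := NTensor.map LinearMap.id (𝔠.counit.comp (adjCounitBimod adj)).left)
        (g := (NTensor.map LinearMap.id 𝔠.counit.left).comp
          (NTensor.map LinearMap.id (adjCounitBimod adj).left))
        (NTensor.hom_ext fun _ _ => rfl) _)
    · exact congrArg (NTensor.lid A C) (DFunLike.congr_fun
        (f := (NTensor.map 𝔠.counit.right LinearMap.id).comp
          (NTensor.map (adjCounitBimod adj).right LinearMap.id))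
        (g := NTensor.map (𝔠.counit.comp (adjCounitBimod adj)).right LinearMap.id)
        (NTensor.hom_ext fun _ _ => rfl) _)
  pairing_elt c := by
    rw [BimodHom.comp_apply, adjCounitBimod_apply, ← adjUnit_eq]
    exact congrArg 𝔠.counit (adjCounit_adjUnit adj 𝔠.regular c)
  elt_pairing c := by
    have h := adjCounitCofree_rmap_adjUnit adj A (NTensor.tmul A 1 c)
    have h1 : rmap C (adjUnit adj A) (NTensor.tmul A 1 c) =
        NTensor.tmul A (NTensor.tmul A 1 (adjElt adj)) c :=
      congrArg (fun y => NTensor.tmul A y c) (adjUnit_eq adj A 1)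
    rw [h1, adjCounitCofree_tmul] at h
    have h2 := congrArg (NTensor.lid A C) h
    rw [NTensor.lid_tmul, NTensor.lid_tmul, one_smul, one_smul] at h2
    exact congrArg 𝔠.counit h2

end OfAdjunction

/-- A Frobenius coring has a Frobenius system. A two-sided adjoint of the forgetful functor is
isomorphic to the cofree comodule functor, because right adjoints are unique. -/
theorem IsFrobenius.nonempty_frobeniusSystem {𝔠 : Coring A C} (h : 𝔠.IsFrobenius) :
    Nonempty 𝔠.FrobeniusSystem := by
  obtain ⟨G, ⟨adj₁⟩, ⟨adj₂⟩⟩ := h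
  exact ⟨frobeniusSystemOfAdjunction
    (adj₂.ofNatIsoLeft (adj₁.rightAdjointUniq 𝔠.forgetCofreeAdjunction))⟩

end Coring

theorem proposition3p6
    {A B D Sig : Type u} [Ring A] [Ring B]
    [AddCommGroup D] [Module B D] [Module Bᵐᵒᵖ D] [SMulCommClass B Bᵐᵒᵖ D]
    (𝔡 : Coring B D)
    [AddCommGroup Sig] [Module B Sig] [Module Aᵐᵒᵖ Sig] [SMulCommClass B Aᵐᵒᵖ Sig]
    [Module.Finite Aᵐᵒᵖ Sig] [Module.Projective Aᵐᵒᵖ Sig] :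
    (IsSeparableBimodule B A Sig → 𝔡.IsCoseparable → (𝔡.baseExtension A Sig).IsCoseparable) ∧
    (IsSeparableBimodule A B (RDual A Sig) → 𝔡.IsCosplit → (𝔡.baseExtension A Sig).IsCosplit) ∧
    ((𝔡.baseExtension A Sig).IsCosplit → IsSeparableBimodule A B (RDual A Sig)) ∧
    (IsFrobeniusBimodule B A Sig → 𝔡.IsFrobenius → (𝔡.baseExtension A Sig).IsFrobenius) := by
  refine ⟨fun hM h => h.baseExtensionOf _ hM, fun hM h => h.baseExtensionOf _ hM,
    fun h => h.isSeparableBimodule, fun hM h => ?_⟩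
  obtain ⟨S⟩ := h.nonempty_frobeniusSystem
  obtain ⟨S'⟩ := S.nonempty_baseExtensionOf (dualBasis A Sig) hM
  exact S'.isFrobenius
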